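/- Let $n\ge 1$ and $0<\alpha<n$. Let $\sigma$ be surface measure on the unit sphere $\mathbb S^{n-1}\subset\mathbb R^n$ (counting measure if $n=1$), and for measurable $\Omega$ on $\mathbb S^{n-1}$ put $$\|\Omega\|_{L^{n,\infty}(\mathbb S^{n-1})}=\sup_{t>0}t\,\sigma(\{y'\in\mathbb S^{n-1}:|\Omega(y')|>t\})^{1/n}.$$ For $f\in C_c^\infty(\mathbb R^n)$ let $$T_{\Omega,\alpha}f(x)=\mathrm{p.v.}\int_{\mathbb R^n}\frac{\Omega(y/|y|)}{|y|^{n+1-\alpha}}f(x-y)\,dy=\lim_{\varepsilon\to0^+}\int_{|y|>\varepsilon}\frac{\Omega(y/|y|)}{|y|^{n+1-\alpha}}f(x-y)\,dy ,$$ and let $$I_\alpha g(x)=c_{n,\alpha}\int_{\mathbb R^n}\frac{g(y)}{|x-y|^{n-\alpha}}\,dy,\qquad c_{n,\alpha}=\frac{\Gamma(\frac{n-\alpha}{2})}{2^{\alpha}\pi^{n/2}\Gamma(\frac{\alpha}{2})},$$ be the Riesz potential. A dyadic grid is a collection $\mathscr D$ of (half-open, axis-parallel) cubes whose side lengths are integer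 powers of $2$, such that for each $k\in\mathbb Z$ the cubes of side length $2^k$ in $\mathscr D$ partition $\mathbb R^n$, and $P\cap Q\in\{\varnothing,P,Q\}$ for all $P,Q\in\mathscr D$. A sparse family is a subfamily $\mathscr S$ of a dyadic grid for which there are pairwise disjoint measurable sets $E_Q\subseteq Q$, $Q\in\mathscr S$, with $|Q|\le 2|E_Q|$; for such a family let $$I_\alpha^{\mathscr S}g(x)=\sum_{Q\in\mathscr S}\ell(Q)^\alpha\Big(\frac1{|Q|}\int_Q g\Big)\mathbf 1_Q(x),$$ where $\ell(Q)$ is the side length of $Q$. There are a constant $c>0$ and a natural number $N$, depending only on $n$ and $\alpha$, such that the following holds for every $\Omega\in L^{n,\infty}(\mathbb S^{n-1})$ with $\int_{\mathbb S^{n-1}}\Omega\,d\sigma=0$ and every $f\in C_c^\infty(\mathbb R^n)$ (both real-valued or both complex-valued). 1. For every $x\in\mathbb R^n$ the truncated integrals converge absolutely, the limit defining $T_{\Omega,\alpha}f(x)$ exists, the integral defining $I_\alpha(|\nabla f|)(x)$ converges, and $$|T_{\Omega,\alpha}f(x)|\le c\,\|\Omega\|_{L^{n,\infty}(\mathbb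 S^{n-1})}\,I_\alpha(|\nabla f|)(x).$$ 2. There are sparse families $\mathscr S_1,\dots,\mathscr S_N$ such that for every $x\in\mathbb R^n$ the sums $I_\alpha^{\mathscr S_k}(|\nabla f|)(x)$ converge and $$|T_{\Omega,\alpha}f(x)|\le c\,\|\Omega\|_{L^{n,\infty}(\mathbb S^{n-1})}\sum_{k=1}^N I_\alpha^{\mathscr S_k}(|\nabla f|)(x).$$ -/

import Mathlib

open MeasureTheory Filter Topology
open scoped ContDiff ENNReal

noncomputable section

namespace RoughOperator

/-- The `L^{p,∞}` (weak Lebesgue) quasinorm `sup_{t > 0} t * μ {x | |g x| > t} ^ (1 / p)`. -/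
def weakNorm {X 𝕜 : Type*} [MeasurableSpace X] [RCLike 𝕜] (p : ℝ) (μ : Measure X)
    (g : X → 𝕜) : ℝ≥0∞ :=
  ⨆ (t : ℝ) (_ : 0 < t), ENNReal.ofReal t * μ {x | t < ‖g x‖} ^ (1 / p)

/-- Membership in `L^{p,∞}(μ)`. -/
def MemWeakLp {X 𝕜 : Type*} [MeasurableSpace X] [RCLike 𝕜] (p : ℝ) (μ : Measure X)
    (g : X → 𝕜) : Prop :=
  AEStronglyMeasurable g μ ∧ weakNorm p μ g < ⊤

/-- Surface measure on the unit sphere of `ℝⁿ` (for `n = 1`, counting measure on `{-1, 1}`). -/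
def surfaceMeasure (n : ℕ) : Measure (Metric.sphere (0 : EuclideanSpace ℝ (Fin n)) 1) :=
  (volume : Measure (EuclideanSpace ℝ (Fin n))).toSphere

/-- The function `y ↦ Ω (y / |y|)` on `ℝⁿ`; its value at the origin is irrelevant. -/
def homogeneousExt {n : ℕ} {𝕜 : Type*} [RCLike 𝕜]
    (Ω : Metric.sphere (0 : EuclideanSpace ℝ (Fin n)) 1 → 𝕜) (y : EuclideanSpace ℝ (Fin n)) : 𝕜 :=
  if h : y = 0 then 0
  else Ω ⟨‖y‖⁻¹ • y, by simp [norm_smul, inv_mul_cancel₀ (norm_ne_zero_iff.mpr h)]⟩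

/-- The integrand `Ω (y') |y|^{-(n+1-α)} f (x - y)`. -/
def roughIntegrand {n : ℕ} {𝕜 : Type*} [RCLike 𝕜] (α : ℝ)
    (Ω : Metric.sphere (0 : EuclideanSpace ℝ (Fin n)) 1 → 𝕜)
    (f : EuclideanSpace ℝ (Fin n) → 𝕜) (x y : EuclideanSpace ℝ (Fin n)) : 𝕜 :=
  (‖y‖ ^ ((n : ℝ) + 1 - α))⁻¹ • (homogeneousExt Ω y * f (x - y))

/-- The truncated integral over `{|y| > ε}`. -/
def roughTrunc {n : ℕ} {𝕜 : Type*} [RCLike 𝕜] (α : ℝ)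
    (Ω : Metric.sphere (0 : EuclideanSpace ℝ (Fin n)) 1 → 𝕜)
    (f : EuclideanSpace ℝ (Fin n) → 𝕜) (x : EuclideanSpace ℝ (Fin n)) (ε : ℝ) : 𝕜 :=
  ∫ y in {y : EuclideanSpace ℝ (Fin n) | ε < ‖y‖}, roughIntegrand α Ω f x y

/-- The rough operator `T_{Ω,α} f (x) = p.v. ∫ Ω (y') |y|^{-(n+1-α)} f (x - y) dy`, the principal
value being the limit of the truncated integrals as `ε → 0+`. -/
def roughOp {n : ℕ} {𝕜 : Type*} [RCLike 𝕜] (α : ℝ)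
    (Ω : Metric.sphere (0 : EuclideanSpace ℝ (Fin n)) 1 → 𝕜)
    (f : EuclideanSpace ℝ (Fin n) → 𝕜) (x : EuclideanSpace ℝ (Fin n)) : 𝕜 :=
  limUnder (𝓝[>] (0 : ℝ)) (roughTrunc α Ω f x)

/-- The Euclidean length `|∇f (x)|` of the gradient (of the vector of partial derivatives). -/
def gradNorm {n : ℕ} {𝕜 : Type*} [RCLike 𝕜] (f : EuclideanSpace ℝ (Fin n) → 𝕜)
    (x : EuclideanSpace ℝ (Fin n)) : ℝ :=
  Real.sqrt (∑ i : Fin n, ‖fderiv ℝ f x (EuclideanSpace.single i (1 : ℝ))‖ ^ 2)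

/-- The constant `c_{n,α} = Γ((n-α)/2) / (2^α π^{n/2} Γ(α/2))` for which the Riesz potential is the
Fourier multiplier `|ξ|^{-α}`, the Fourier transform being `∫ f (x) exp (-i x·ξ) dx`. -/
def rieszConst (n : ℕ) (α : ℝ) : ℝ :=
  Real.Gamma (((n : ℝ) - α) / 2) /
    ((2 : ℝ) ^ α * Real.pi ^ ((n : ℝ) / 2) * Real.Gamma (α / 2))

/-- The Riesz potential `I_α g (x) = c_{n,α} ∫ g (y) / |x - y|^{n-α} dy`. -/
def rieszPotential {n : ℕ} (α : ℝ) (g : EuclideanSpace ℝ (Fin n) → ℝ)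
    (x : EuclideanSpace ℝ (Fin n)) : ℝ :=
  rieszConst n α * ∫ y, g y / ‖x - y‖ ^ ((n : ℝ) - α)

/-- A (half-open, axis-parallel) cube in `ℝⁿ`, given by its lower corner and its side length. -/
@[ext] structure Cube (n : ℕ) where
  corner : Fin n → ℝ
  side : ℝ
  side_pos : 0 < side

/-- The points of a cube. -/
def Cube.toSet {n : ℕ} (Q : Cube n) : Set (EuclideanSpace ℝ (Fin n)) :=
  {x | ∀ i, Q.corner i ≤ x i ∧ x i < Q.corner i + Q.side}

/-- A dyadic grid: side lengths are powers of two, the cubes of each fixed side length `2 ^ k`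
partition `ℝⁿ`, and two cubes are nested or disjoint. -/
structure IsDyadicGrid {n : ℕ} (D : Set (Cube n)) : Prop where
  side_eq : ∀ Q ∈ D, ∃ k : ℤ, Q.side = (2 : ℝ) ^ k
  partition : ∀ (k : ℤ) (x : EuclideanSpace ℝ (Fin n)),
    ∃! Q : Cube n, Q ∈ D ∧ Q.side = (2 : ℝ) ^ k ∧ x ∈ Q.toSet
  nested : ∀ P ∈ D, ∀ Q ∈ D, P.toSet ∩ Q.toSet = ∅ ∨
    P.toSet ∩ Q.toSet = P.toSet ∨ P.toSet ∩ Q.toSet = Q.toSet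

/-- A sparse family of cubes: a subfamily `S` of a dyadic grid whose cubes `Q` contain pairwise
disjoint measurable sets `E Q` with `|Q| ≤ 2 |E Q|`. -/
def IsSparse {n : ℕ} (S : Set (Cube n)) : Prop :=
  (∃ D : Set (Cube n), IsDyadicGrid D ∧ S ⊆ D) ∧
  ∃ E : Cube n → Set (EuclideanSpace ℝ (Fin n)),
    (∀ Q ∈ S, MeasurableSet (E Q) ∧ E Q ⊆ Q.toSet ∧ volume Q.toSet ≤ 2 * volume (E Q)) ∧
    S.PairwiseDisjoint E

/-- The term `ℓ(Q)^α (⨍_Q g) 1_Q (x)` of the sparse operator. -/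
def sparseTerm {n : ℕ} (α : ℝ) (g : EuclideanSpace ℝ (Fin n) → ℝ)
    (x : EuclideanSpace ℝ (Fin n)) (Q : Cube n) : ℝ :=
  Q.toSet.indicator (fun _ => Q.side ^ α * ⨍ y in Q.toSet, g y) x

/-- The sparse fractional integral operator
`I_α^S g (x) = ∑_{Q ∈ S} ℓ(Q)^α (⨍_Q g) 1_Q (x)`. -/
def sparseOp {n : ℕ} (S : Set (Cube n)) (α : ℝ) (g : EuclideanSpace ℝ (Fin n) → ℝ)
    (x : EuclideanSpace ℝ (Fin n)) : ℝ :=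
  ∑' Q : S, sparseTerm α g x Q

end RoughOperator

end

/-! Fix `x` and write g(y) = f(x - y). Since Ω has mean zero, y ↦ Ω(y/|y|) is orthogonal to radial
functions, so a truncated integral does not change when g(y) is replaced by g(y) - m(|y|), where
m(R) is the mean of g over the ball B(0, R). A pointwise Poincaré inequality
(`enorm_sub_ballAverage_le`) bounds |g(y) - m(|y|)| by a constant times the integral of |∇g(z)| |y -
z|^(1-n) over |z| ≤ |y|. By Tonelli, everything reduces to the kernel estimate
`lintegral_kernel_le`: the integral of |Ω(y/|y|)| |y|^(-(n+1-α)) |y - z|^(1-n) over |y| ≥ |z| is at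
most C ‖Ω‖ |z|^(α-n). What remains is a multiple of the Riesz potential of |∇f|. Its finiteness
makes the modified integrand absolutely integrable, so the principal value exists by dominated
convergence.

Weak Lⁿ enters near y = z. A ball of radius about δ|z| around z lies in a cone of aperture about δ,
over a cap of measure at most about δ^(n-1). There weak Lⁿ bounds the integral of |Ω| by
δ^((n-1)(1-1/n)) up to constants. With a factor δ from the radial direction and δ^(1-n) from the
singularity, the total is δ^(1/n), which is summable over δ = 2^(-j).

For the sparse bound, the one-third trick puts every ball into a comparable cube of one of 2^n
shifted dyadic grids, so the Riesz potential is dominated by sums of ℓ(Q)^α times the mean over Q,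
taken over all grid cubes containing `x`. Only the cubes at which the mean first exceeds a power of
2^(n+1) are kept. They form a sparse family (`isSparse_stoppingFamily`), and they control the full
sum because the weights ℓ(Q)^α decay geometrically (`tsum_scaleWeight_mul_density_le`). -/

namespace RoughOperator

open Set Metric

/-! ### Polar coordinates and homogeneous functions -/

section Polar

variable {n : ℕ} {𝕜 : Type*} [RCLike 𝕜]

lemma homogeneousExt_coe (Ω : sphere (0 : EuclideanSpace ℝ (Fin n)) 1 → 𝕜)
    (y : ({0}ᶜ : Set (EuclideanSpace ℝ (Fin n)))) :
    homogeneousExt Ω (y : EuclideanSpace ℝ (Fin n)) =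
      Ω (homeomorphUnitSphereProd (EuclideanSpace ℝ (Fin n)) y).1 := by
  have hy : (y : EuclideanSpace ℝ (Fin n)) ≠ 0 := y.2
  rw [homogeneousExt, dif_neg hy]
  congr 1
  ext1
  simp

lemma homogeneousExt_smul (Ω : sphere (0 : EuclideanSpace ℝ (Fin n)) 1 → 𝕜)
    (θ : sphere (0 : EuclideanSpace ℝ (Fin n)) 1) {r : ℝ} (hr : 0 < r) :
    homogeneousExt Ω (r • (θ : EuclideanSpace ℝ (Fin n))) = Ω θ := by
  have hθ : ‖(θ : EuclideanSpace ℝ (Fin n))‖ = 1 := by simp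
  have h0 : r • (θ : EuclideanSpace ℝ (Fin n)) ≠ 0 := by
    rw [← norm_ne_zero_iff, norm_smul, hθ]
    simpa using hr.ne'
  rw [homogeneousExt, dif_neg h0]
  congr 1
  ext1
  simp [norm_smul, hθ, abs_of_pos hr, smul_smul, hr.ne']

lemma measurePreserving_polar (n : ℕ) :
    MeasurePreserving (homeomorphUnitSphereProd (EuclideanSpace ℝ (Fin n)))
      ((volume : Measure (EuclideanSpace ℝ (Fin n))).comap (↑))
      ((surfaceMeasure n).prod (Measure.volumeIoiPow (n - 1))) := by
  have := (volume : Measure (EuclideanSpace ℝ (Fin n))).measurePreserving_homeomorphUnitSphereProd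
  simpa [surfaceMeasure] using this

instance : IsFiniteMeasure (surfaceMeasure n) := by
  unfold surfaceMeasure; infer_instance

lemma restrict_compl_zero (hn : 0 < n) :
    (volume : Measure (EuclideanSpace ℝ (Fin n))).restrict {0}ᶜ = volume := by
  have : Nonempty (Fin n) := ⟨⟨0, hn⟩⟩
  exact restrict_compl_singleton 0

/-- Integration in polar coordinates. -/
lemma lintegral_polar (hn : 0 < n) {F : EuclideanSpace ℝ (Fin n) → ℝ≥0∞}
    (hF : AEMeasurable F volume) :
    ∫⁻ y, F y = ∫⁻ θ, (∫⁻ r in Ioi (0 : ℝ), ENNReal.ofReal (r ^ (n - 1)) *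
      F (r • (θ : EuclideanSpace ℝ (Fin n)))) ∂(surfaceMeasure n) := by
  have hmp := measurePreserving_polar n
  have hemb := (homeomorphUnitSphereProd (EuclideanSpace ℝ (Fin n))).measurableEmbedding
  have hms : MeasurableSet ({0}ᶜ : Set (EuclideanSpace ℝ (Fin n))) :=
    (measurableSet_singleton _).compl
  set Φ : sphere (0 : EuclideanSpace ℝ (Fin n)) 1 × Ioi (0 : ℝ) → ℝ≥0∞ :=
    fun p => F ((p.2 : ℝ) • (p.1 : EuclideanSpace ℝ (Fin n))) with hΦ
  have hcomp : (fun y : ({0}ᶜ : Set (EuclideanSpace ℝ (Fin n))) => F y) =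
      Φ ∘ homeomorphUnitSphereProd (EuclideanSpace ℝ (Fin n)) := by
    funext y
    have hy : (y : EuclideanSpace ℝ (Fin n)) ≠ 0 := y.2
    simp [hΦ, smul_smul, hy]
  have hae : AEMeasurable (fun y : ({0}ᶜ : Set (EuclideanSpace ℝ (Fin n))) => F y)
      ((volume : Measure (EuclideanSpace ℝ (Fin n))).comap (↑)) := by
    have hF' : AEMeasurable F (volume.restrict {0}ᶜ) := hF.restrict
    rw [← map_comap_subtype_coe hms] at hF'
    exact hF'.comp_measurable measurable_subtype_coe
  have hΦm : AEMeasurable Φ ((surfaceMeasure n).prod (Measure.volumeIoiPow (n - 1))) := by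
    rw [← hmp.map_eq, hemb.aemeasurable_map_iff, ← hcomp]
    exact hae
  calc ∫⁻ y, F y = ∫⁻ y in {0}ᶜ, F y := by rw [restrict_compl_zero hn]
    _ = ∫⁻ y : ({0}ᶜ : Set (EuclideanSpace ℝ (Fin n))), F y
          ∂((volume : Measure (EuclideanSpace ℝ (Fin n))).comap (↑)) := by
        rw [← lintegral_subtype_comap hms]
    _ = ∫⁻ p, Φ p ∂((surfaceMeasure n).prod (Measure.volumeIoiPow (n - 1))) := by
        rw [← hmp.lintegral_comp_emb hemb, hcomp]; rfl
    _ = ∫⁻ θ, (∫⁻ r, Φ (θ, r) ∂(Measure.volumeIoiPow (n - 1))) ∂(surfaceMeasure n) :=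
        lintegral_prod _ hΦm
    _ = _ := by
        refine lintegral_congr fun θ => ?_
        rw [Measure.volumeIoiPow, lintegral_withDensity_eq_lintegral_mul_non_measurable₀]
        · exact lintegral_subtype_comap measurableSet_Ioi
            (fun r : ℝ => ENNReal.ofReal (r ^ (n - 1)) *
              F (r • (θ : EuclideanSpace ℝ (Fin n))))
        · fun_prop
        · exact ae_of_all _ fun _ => ENNReal.ofReal_lt_top

lemma aestronglyMeasurable_homogeneousExt (hn : 0 < n)
    {Ω : sphere (0 : EuclideanSpace ℝ (Fin n)) 1 → 𝕜}
    (hΩ : AEStronglyMeasurable Ω (surfaceMeasure n)) :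
    AEStronglyMeasurable (homogeneousExt Ω) volume := by
  have hmp := measurePreserving_polar n
  have hms : MeasurableSet ({0}ᶜ : Set (EuclideanSpace ℝ (Fin n))) :=
    (measurableSet_singleton _).compl
  rw [← restrict_compl_zero hn, ← map_comap_subtype_coe hms,
    (MeasurableEmbedding.subtype_coe hms).aestronglyMeasurable_map_iff]
  have h1 : AEStronglyMeasurable (fun p : sphere (0 : EuclideanSpace ℝ (Fin n)) 1 × Ioi (0 : ℝ) =>
      Ω p.1) ((surfaceMeasure n).prod (Measure.volumeIoiPow (n - 1))) := hΩ.comp_fst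
  have h2 := h1.comp_quasiMeasurePreserving hmp.quasiMeasurePreserving
  refine h2.congr (ae_of_all _ fun y => ?_)
  exact (homogeneousExt_coe Ω y).symm

/-- Polar coordinates for an integral with a homogeneous weight. -/
lemma lintegral_homogeneousExt_mul (hn : 0 < n)
    {Ω : sphere (0 : EuclideanSpace ℝ (Fin n)) 1 → 𝕜}
    (hΩ : AEStronglyMeasurable Ω (surfaceMeasure n))
    {H : EuclideanSpace ℝ (Fin n) → ℝ≥0∞} (hH : Measurable H) :
    ∫⁻ y, ‖homogeneousExt Ω y‖ₑ * H y = ∫⁻ θ, (‖Ω θ‖ₑ * ∫⁻ r in Ioi (0 : ℝ),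
      ENNReal.ofReal (r ^ (n - 1)) * H (r • (θ : EuclideanSpace ℝ (Fin n))))
        ∂(surfaceMeasure n) := by
  rw [lintegral_polar (F := fun y => ‖homogeneousExt Ω y‖ₑ * H y) hn
    ((aestronglyMeasurable_homogeneousExt hn hΩ).enorm.mul hH.aemeasurable)]
  refine lintegral_congr fun θ => ?_
  rw [← lintegral_const_mul' _ _ (by simp)]
  refine setLIntegral_congr_fun measurableSet_Ioi fun r hr => ?_
  rw [homogeneousExt_smul Ω θ hr]
  ring

/-- A homogeneous function of mean zero on the sphere is orthogonal to radial functions. -/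
lemma integral_homogeneousExt_mul_radial (hn : 0 < n)
    {Ω : sphere (0 : EuclideanSpace ℝ (Fin n)) 1 → 𝕜}
    (hΩ0 : ∫ θ, Ω θ ∂(surfaceMeasure n) = 0) (φ : ℝ → 𝕜) :
    ∫ y, homogeneousExt Ω y * φ ‖y‖ = 0 := by
  have hmp := measurePreserving_polar n
  have hemb := (homeomorphUnitSphereProd (EuclideanSpace ℝ (Fin n))).measurableEmbedding
  have hms : MeasurableSet ({0}ᶜ : Set (EuclideanSpace ℝ (Fin n))) :=
    (measurableSet_singleton _).compl
  calc ∫ y, homogeneousExt Ω y * φ ‖y‖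
      = ∫ y in {0}ᶜ, homogeneousExt Ω y * φ ‖y‖ := by rw [restrict_compl_zero hn]
    _ = ∫ y : ({0}ᶜ : Set (EuclideanSpace ℝ (Fin n))),
          homogeneousExt Ω (y : EuclideanSpace ℝ (Fin n)) * φ ‖(y : EuclideanSpace ℝ (Fin n))‖
          ∂((volume : Measure (EuclideanSpace ℝ (Fin n))).comap (↑)) := by
        rw [← integral_subtype_comap hms (fun y => homogeneousExt Ω y * φ ‖y‖)]
    _ = ∫ p, Ω p.1 * φ p.2 ∂((surfaceMeasure n).prod (Measure.volumeIoiPow (n - 1))) := by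
        rw [← hmp.integral_comp hemb]
        refine integral_congr_ae (ae_of_all _ fun y => ?_)
        simp only [homogeneousExt_coe, homeomorphUnitSphereProd_apply_snd_coe]
    _ = 0 := by
        -- The product formula for Bochner integrals needs no integrability, so `φ` may be
        -- arbitrary.
        rw [integral_prod_mul (μ := surfaceMeasure n) (ν := Measure.volumeIoiPow (n - 1)) Ω
          (fun r : Ioi (0 : ℝ) => φ r), hΩ0, zero_mul]

end Polar

open scoped Pointwise NNReal

/-! ### Weak Lⁿ functions on spherical caps -/

section Caps

variable {n : ℕ} {𝕜 : Type*} [RCLike 𝕜]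

/-- The measure of a cap is n times the volume of the cone it spans with the origin. This cone stays
within about δ of the segment from 0 to `e`, so about 1/δ balls of radius 2δ cover it, each of
volume comparable to δ^n. The range δ ≤ 8 suits later caps of radius 8δ with δ ≤ 1, and it includes
the whole sphere. -/
lemma surfaceMeasure_closedBall_le (hn : 0 < n) :
    ∃ C : ℝ, 0 < C ∧ ∀ (e : sphere (0 : EuclideanSpace ℝ (Fin n)) 1) (δ : ℝ), 0 < δ → δ ≤ 8 →
      surfaceMeasure n (closedBall e δ) ≤ ENNReal.ofReal (C * δ ^ (n - 1)) := by
  set v := (volume : Measure (EuclideanSpace ℝ (Fin n))).real (ball 0 1) with hv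
  have hv0 : 0 ≤ v := measureReal_nonneg
  refine ⟨n * (9 * 2 ^ n * v) + 1, by positivity, fun e δ hδ hδ8 => ?_⟩
  have hcover : Ioo (0 : ℝ) 1 • ((↑) '' closedBall e δ : Set (EuclideanSpace ℝ (Fin n))) ⊆
      ⋃ j ∈ Finset.range (⌊1 / δ⌋₊ + 1),
        closedBall (((j : ℝ) * δ) • (e : EuclideanSpace ℝ (Fin n))) (2 * δ) := by
    rintro _ ⟨r, ⟨hr0, hr1⟩, _, ⟨θ, hθ, rfl⟩, rfl⟩
    simp only [mem_iUnion, Finset.mem_range, Nat.lt_succ_iff]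
    refine ⟨⌊r / δ⌋₊, Nat.floor_mono (by gcongr), ?_⟩
    have h1 : ‖(θ : EuclideanSpace ℝ (Fin n)) - e‖ ≤ δ := by
      simpa [Subtype.dist_eq, dist_eq_norm] using hθ
    have he : ‖(e : EuclideanSpace ℝ (Fin n))‖ = 1 := by simp
    have h2 : |r - ⌊r / δ⌋₊ * δ| ≤ δ := by
      have ha := Nat.floor_le (div_nonneg hr0.le hδ.le)
      have hb := Nat.lt_floor_add_one (r / δ)
      rw [le_div_iff₀ hδ] at ha
      rw [div_lt_iff₀ hδ] at hb
      rw [abs_le]; constructor <;> nlinarith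
    rw [mem_closedBall, dist_eq_norm]
    calc ‖r • (θ : EuclideanSpace ℝ (Fin n)) - ((⌊r / δ⌋₊ : ℝ) * δ) • (e : EuclideanSpace ℝ (Fin n))‖
        = ‖r • ((θ : EuclideanSpace ℝ (Fin n)) - e) +
            (r - ⌊r / δ⌋₊ * δ) • (e : EuclideanSpace ℝ (Fin n))‖ := by
          congr 1; module
      _ ≤ r * ‖(θ : EuclideanSpace ℝ (Fin n)) - e‖ + |r - ⌊r / δ⌋₊ * δ| := by
          refine (norm_add_le _ _).trans ?_
          rw [norm_smul, norm_smul, he, Real.norm_eq_abs, Real.norm_eq_abs, abs_of_pos hr0, mul_one]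
      _ ≤ 2 * δ := by nlinarith [norm_nonneg ((θ : EuclideanSpace ℝ (Fin n)) - e)]
  have hvol : ∀ c : EuclideanSpace ℝ (Fin n),
      volume (closedBall c (2 * δ)) = ENNReal.ofReal ((2 * δ) ^ n * v) := by
    intro c
    rw [Measure.addHaar_closedBall _ _ (by positivity), hv, ENNReal.ofReal_mul (by positivity),
      ofReal_measureReal]
    simp
  rw [surfaceMeasure, Measure.toSphere_apply' _ measurableSet_closedBall]
  calc (Module.finrank ℝ (EuclideanSpace ℝ (Fin n)) : ℝ≥0∞) *
        volume (Ioo (0 : ℝ) 1 • ((↑) '' closedBall e δ : Set (EuclideanSpace ℝ (Fin n))))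
      ≤ n * ∑ j ∈ Finset.range (⌊1 / δ⌋₊ + 1), ENNReal.ofReal ((2 * δ) ^ n * v) := by
        rw [finrank_euclideanSpace_fin]
        gcongr
        refine (measure_mono hcover).trans ((measure_biUnion_finset_le _ _).trans ?_)
        simp_rw [hvol]; rfl
    _ = ENNReal.ofReal (n * ((⌊1 / δ⌋₊ + 1) * ((2 * δ) ^ n * v))) := by
        rw [Finset.sum_const, Finset.card_range, nsmul_eq_mul,
          ENNReal.ofReal_mul (p := (n : ℝ)) (by positivity),
          ENNReal.ofReal_mul (p := (⌊1 / δ⌋₊ : ℝ) + 1) (by positivity), ENNReal.ofReal_natCast,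
          ← Nat.cast_succ, ENNReal.ofReal_natCast]
    _ ≤ _ := by
        apply ENNReal.ofReal_le_ofReal
        have h1 : (⌊1 / δ⌋₊ : ℝ) ≤ 1 / δ := Nat.floor_le (by positivity)
        have h2 : ((1 / δ) + 1) * ((2 * δ) ^ n * v) ≤ 9 * 2 ^ n * v * δ ^ (n - 1) := by
          obtain ⟨m, rfl⟩ : ∃ m, n = m + 1 := ⟨n - 1, by omega⟩
          have : ((1 / δ) + 1) * ((2 * δ) ^ (m + 1) * v) = (1 + δ) * (2 ^ (m + 1) * v * δ ^ m) := by
            rw [mul_pow, pow_succ δ]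
            field_simp
          rw [this, Nat.add_sub_cancel]
          have : (1 + δ) * (2 ^ (m + 1) * v * δ ^ m) ≤ 9 * (2 ^ (m + 1) * v * δ ^ m) := by
            gcongr; linarith
          linarith
        calc (n : ℝ) * ((⌊1 / δ⌋₊ + 1) * ((2 * δ) ^ n * v))
            ≤ n * (((1 / δ) + 1) * ((2 * δ) ^ n * v)) := by gcongr
          _ ≤ n * (9 * 2 ^ n * v * δ ^ (n - 1)) := by gcongr
          _ ≤ _ := by nlinarith [pow_pos hδ (n - 1)]

lemma measure_lt_norm_le_weakNorm {X : Type*} [MeasurableSpace X] {μ : Measure X} {g : X → 𝕜}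
    (hn : 0 < n) {t : ℝ} (ht : 0 < t) (hA : weakNorm (n : ℝ) μ g < ⊤) :
    μ {x | t < ‖g x‖} ≤ ENNReal.ofReal (((weakNorm (n : ℝ) μ g).toReal / t) ^ n) := by
  set A := weakNorm (n : ℝ) μ g
  have h1 : ENNReal.ofReal t * μ {x | t < ‖g x‖} ^ (1 / (n : ℝ)) ≤ A :=
    le_iSup₂ (f := fun (t : ℝ) (_ : 0 < t) =>
      ENNReal.ofReal t * μ {x | t < ‖g x‖} ^ (1 / (n : ℝ))) t ht
  have h2 : μ {x | t < ‖g x‖} ^ (1 / (n : ℝ)) ≤ ENNReal.ofReal (A.toReal / t) := by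
    rw [ENNReal.ofReal_div_of_pos ht, ENNReal.ofReal_toReal hA.ne,
      ENNReal.le_div_iff_mul_le (by simp [ht]) (by simp), mul_comm]
    exact h1
  have h3 := ENNReal.rpow_le_rpow h2 (Nat.cast_nonneg n)
  rw [← ENNReal.rpow_mul, one_div_mul_cancel (by positivity), ENNReal.rpow_one,
    ENNReal.rpow_natCast, ← ENNReal.ofReal_pow (by positivity)] at h3
  exact h3

/-- Layer-cake bound for a function in weak `Lⁿ`, `n ≥ 2`, on a set of finite measure. -/
lemma lintegral_enorm_le_of_weak {X : Type*} [MeasurableSpace X] {μ : Measure X} {g : X → 𝕜}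
    (hg : AEStronglyMeasurable g μ) {n : ℕ} (hn : 2 ≤ n) {a M T : ℝ} (ha : 0 ≤ a) (hM : 0 ≤ M)
    (hT : 0 < T) (hμ : μ univ ≤ ENNReal.ofReal M)
    (hd : ∀ t, 0 < t → μ {x | t < ‖g x‖} ≤ ENNReal.ofReal ((a / t) ^ n)) :
    ∫⁻ x, ‖g x‖ₑ ∂μ ≤ ENNReal.ofReal (M * T + a ^ n * T ^ (1 - (n : ℝ))) := by
  have hn' : (2 : ℝ) ≤ n := by exact_mod_cast hn
  have h1 : ∫⁻ x, ‖g x‖ₑ ∂μ = ∫⁻ t in Ioi 0, μ {x | t < ‖g x‖} := by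
    rw [← lintegral_eq_lintegral_meas_lt μ (ae_of_all _ fun x => norm_nonneg _)
      hg.norm.aemeasurable]
    simp_rw [ofReal_norm]
  rw [h1, ← Ioc_union_Ioi_eq_Ioi hT.le, lintegral_union measurableSet_Ioi Ioc_disjoint_Ioi_same,
    ENNReal.ofReal_add (by positivity) (by positivity)]
  gcongr
  · calc ∫⁻ t in Ioc 0 T, μ {x | t < ‖g x‖} ≤ ∫⁻ t in Ioc 0 T, ENNReal.ofReal M :=
          lintegral_mono fun t => (measure_mono (subset_univ _)).trans hμ
      _ = _ := by
          rw [setLIntegral_const, Real.volume_Ioc, sub_zero, ENNReal.ofReal_mul hM]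
  -- The tail of t^(-n) converges because n ≥ 2; the resulting factor 1/(n-1) is at most 1 and is
  -- dropped.
  · have hint := integrableOn_Ioi_rpow_of_lt (a := -(n : ℝ)) (by linarith) hT
    calc ∫⁻ t in Ioi T, μ {x | t < ‖g x‖}
        ≤ ∫⁻ t in Ioi T, ENNReal.ofReal (a ^ n * t ^ (-(n : ℝ))) := by
          refine setLIntegral_mono' measurableSet_Ioi fun t ht => ?_
          have ht0 : 0 < t := hT.trans ht
          refine (hd t ht0).trans (le_of_eq ?_)
          rw [div_pow, Real.rpow_neg ht0.le, Real.rpow_natCast, div_eq_mul_inv]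
      _ = ENNReal.ofReal (∫ t in Ioi T, a ^ n * t ^ (-(n : ℝ))) := by
          rw [ofReal_integral_eq_lintegral_ofReal (hint.const_mul _)]
          filter_upwards [ae_restrict_mem measurableSet_Ioi] with t ht
          have : 0 < t := hT.trans ht
          positivity
      _ ≤ _ := by
          apply ENNReal.ofReal_le_ofReal
          rw [integral_const_mul, integral_Ioi_rpow_of_lt (by linarith) hT]
          gcongr
          rw [show -(n : ℝ) + 1 = -(n - 1) by ring, show 1 - (n : ℝ) = -(n - 1) by ring, neg_div_neg_eq]
          exact div_le_self (by positivity) (by linarith)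

/-- The integral of a weak `Lⁿ` function over a spherical cap of radius `δ`. -/
lemma lintegral_closedBall_enorm_le (hn : 0 < n) :
    ∃ C : ℝ, 0 < C ∧ ∀ Ω : sphere (0 : EuclideanSpace ℝ (Fin n)) 1 → 𝕜,
      MemWeakLp (n : ℝ) (surfaceMeasure n) Ω →
      ∀ (e : sphere (0 : EuclideanSpace ℝ (Fin n)) 1) (δ : ℝ), 0 < δ → δ ≤ 8 →
      ∫⁻ θ in closedBall e δ, ‖Ω θ‖ₑ ∂(surfaceMeasure n) ≤
        ENNReal.ofReal (C * (weakNorm (n : ℝ) (surfaceMeasure n) Ω).toReal *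
          δ ^ (((n : ℝ) - 1) ^ 2 / n)) := by
  obtain ⟨C, hC, hcap⟩ := surfaceMeasure_closedBall_le hn
  -- The layer-cake tail diverges for n = 1, which is treated separately.
  rcases Nat.lt_or_ge 1 n with hn2 | hn1
  · refine ⟨C + 1, by positivity, fun Ω ⟨hΩm, hΩ⟩ e δ hδ hδ8 => ?_⟩
    have hd := fun t (ht : 0 < t) => measure_lt_norm_le_weakNorm hn ht hΩ
    set a := (weakNorm (n : ℝ) (surfaceMeasure n) Ω).toReal with ha
    have ha0 : 0 ≤ a := ENNReal.toReal_nonneg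
    have hn0 : (0 : ℝ) < n := by positivity
    have hd' : ∀ t, 0 < t → (surfaceMeasure n).restrict (closedBall e δ) {x | t < ‖Ω x‖} ≤
        ENNReal.ofReal ((a / t) ^ n) :=
      fun t ht => (Measure.restrict_apply_le _ _).trans (hd t ht)
    have hμ : (surfaceMeasure n).restrict (closedBall e δ) univ ≤
        ENNReal.ofReal (C * δ ^ (n - 1)) := by
      rw [Measure.restrict_apply_univ]; exact hcap e δ hδ hδ8
    -- The threshold used below is proportional to `a` and must be positive. If a = 0, the
    -- distribution function vanishes and so does the integral.
    rcases ha0.eq_or_lt with h0 | hapos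
    · rw [← h0] at hd' ⊢
      have h1 : ∫⁻ x in closedBall e δ, ‖Ω x‖ₑ ∂(surfaceMeasure n) =
          ∫⁻ t in Ioi 0, (surfaceMeasure n).restrict (closedBall e δ) {x | t < ‖Ω x‖} := by
        rw [← lintegral_eq_lintegral_meas_lt _ (ae_of_all _ fun x => norm_nonneg _)
          hΩm.restrict.norm.aemeasurable]
        simp_rw [ofReal_norm]
      rw [h1]
      refine (setLIntegral_mono' measurableSet_Ioi hd').trans ?_
      simp [hn.ne']
    -- This `T` balances the two terms: the cap has measure about δ^(n-1), and (a/T)^n = δ^(n-1).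
    · refine (lintegral_enorm_le_of_weak hΩm.restrict hn2 ha0 (by positivity)
        (T := a * δ ^ (-((n - 1) / n : ℝ))) (by positivity) hμ hd').trans ?_
      apply ENNReal.ofReal_le_ofReal
      have e1 : C * δ ^ (n - 1) * (a * δ ^ (-((n - 1) / n : ℝ))) =
          C * a * δ ^ (((n : ℝ) - 1) ^ 2 / n) := by
        rw [← Real.rpow_natCast, Nat.cast_sub hn, Nat.cast_one]
        have : δ ^ (((n : ℝ) - 1) ^ 2 / n) = δ ^ ((n : ℝ) - 1) * δ ^ (-((n - 1) / n : ℝ)) := by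
          rw [← Real.rpow_add hδ]; congr 1; field_simp; ring
        rw [this]; ring
      have e2 : a ^ n * (a * δ ^ (-((n - 1) / n : ℝ))) ^ (1 - (n : ℝ)) =
          a * δ ^ (((n : ℝ) - 1) ^ 2 / n) := by
        rw [Real.mul_rpow hapos.le (by positivity), ← Real.rpow_mul hδ.le, ← mul_assoc,
          ← Real.rpow_natCast, ← Real.rpow_add hapos]
        congr 1
        · rw [show (n : ℝ) + (1 - n) = 1 by ring, Real.rpow_one]
        · congr 1; field_simp; ring
      rw [e1, e2]
      apply le_of_eq; ring
  -- The sphere now consists of atoms of mass at least `b`, so weak L¹ bounds |Ω| at every point by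
  -- a/b. The exponent of δ is 0.
  · obtain rfl : n = 1 := by omega
    set b : ℝ := (Measure.toSphereBallBound 1 1 : ℝ) *
      (volume : Measure (EuclideanSpace ℝ (Fin 1))).real (ball 0 1) with hb
    have hb0 : 0 < b := by
      refine mul_pos (by exact_mod_cast Measure.toSphereBallBound_pos 1 1) ?_
      rw [measureReal_def]
      exact ENNReal.toReal_pos (isOpen_ball.measure_ne_zero _ (by simp)) measure_ball_lt_top.ne
    have hsing : ∀ θ : sphere (0 : EuclideanSpace ℝ (Fin 1)) 1,
        ENNReal.ofReal b ≤ surfaceMeasure 1 {θ} := by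
      intro θ
      have h1 := Measure.toSphereBallBound_mul_measure_unitBall_le_toSphere_ball
        (volume : Measure (EuclideanSpace ℝ (Fin 1))) one_pos θ
      have h2 : ball θ 1 = {θ} := by
        ext η
        simp only [mem_ball, mem_singleton_iff]
        refine ⟨fun h => ?_, fun h => by simp [h]⟩
        have hη := η.2
        have hθ := θ.2
        rw [Subtype.dist_eq, EuclideanSpace.dist_eq] at h
        simp only [mem_sphere_iff_norm, sub_zero, EuclideanSpace.norm_eq, Finset.univ_unique,
          Finset.sum_singleton,
          Fin.default_eq_zero, Real.norm_eq_abs, Real.dist_eq, Real.sqrt_sq (abs_nonneg _)] at h hη hθ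
        ext i
        fin_cases i
        simp only [Fin.zero_eta]
        rcases (abs_eq zero_le_one).1 hη with h1 | h1 <;>
          rcases (abs_eq zero_le_one).1 hθ with h2 | h2 <;> rw [h1, h2] at h ⊢ <;> norm_num at h
      rw [h2, finrank_euclideanSpace_fin] at h1
      rw [surfaceMeasure, hb, ENNReal.ofReal_mul (by positivity), ofReal_measureReal]
      simpa using h1
    refine ⟨b⁻¹ * C, by positivity, fun Ω ⟨hΩm, hΩ⟩ e δ hδ hδ8 => ?_⟩
    have hd := fun t (ht : 0 < t) => measure_lt_norm_le_weakNorm one_pos ht hΩ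
    set a := (weakNorm ((1 : ℕ) : ℝ) (surfaceMeasure 1) Ω).toReal with ha
    have ha0 : 0 ≤ a := ENNReal.toReal_nonneg
    have hpt : ∀ θ, ‖Ω θ‖ ≤ b⁻¹ * a := by
      intro θ
      refine le_of_forall_lt_imp_le_of_dense fun t ht => ?_
      rcases le_or_gt t 0 with h0 | h0
      · exact h0.trans (by positivity)
      have h1 : surfaceMeasure 1 {θ} ≤ surfaceMeasure 1 {x | t < ‖Ω x‖} :=
        measure_mono (by simpa using ht)
      have h2 := ((hsing θ).trans h1).trans (hd t h0)
      rw [pow_one, ENNReal.ofReal_le_ofReal_iff (by positivity), le_div_iff₀ h0] at h2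
      rw [inv_mul_eq_div, le_div_iff₀ hb0]
      linarith
    calc ∫⁻ θ in closedBall e δ, ‖Ω θ‖ₑ ∂(surfaceMeasure 1)
        ≤ ∫⁻ θ in closedBall e δ, ENNReal.ofReal (b⁻¹ * a) ∂(surfaceMeasure 1) := by
          refine lintegral_mono fun θ => ?_
          rw [← ofReal_norm]
          exact ENNReal.ofReal_le_ofReal (hpt θ)
      _ ≤ ENNReal.ofReal (b⁻¹ * a) * ENNReal.ofReal C := by
          rw [setLIntegral_const]
          gcongr
          simpa using hcap e δ hδ hδ8
      _ = _ := by
          rw [← ENNReal.ofReal_mul (by positivity)]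
          congr 1
          simp
          ring

end Caps

/-! ### The rough kernel against |y - z|^(1-n) -/

section Kernel

variable {n : ℕ} {𝕜 : Type*} [RCLike 𝕜]

/-- The unit vector in the direction of a nonzero vector. -/
noncomputable def direction (z : EuclideanSpace ℝ (Fin n)) (hz : z ≠ 0) :
    sphere (0 : EuclideanSpace ℝ (Fin n)) 1 :=
  ⟨‖z‖⁻¹ • z, by simp [norm_smul, inv_mul_cancel₀ (norm_ne_zero_iff.mpr hz)]⟩

/-- A small ball around `z` lies in a thin piece of a cone around the ray through `z`. -/
lemma lintegral_homogeneousExt_closedBall_le (hn : 0 < n) :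
    ∃ C : ℝ, 0 < C ∧ ∀ Ω : sphere (0 : EuclideanSpace ℝ (Fin n)) 1 → 𝕜,
      MemWeakLp (n : ℝ) (surfaceMeasure n) Ω →
      ∀ (z : EuclideanSpace ℝ (Fin n)) (δ : ℝ), z ≠ 0 → 0 < δ → δ ≤ 1 →
      ∫⁻ y in closedBall z (4 * ‖z‖ * δ), ‖homogeneousExt Ω y‖ₑ ≤
        ENNReal.ofReal (C * (weakNorm (n : ℝ) (surfaceMeasure n) Ω).toReal * ‖z‖ ^ n * δ *
          δ ^ (((n : ℝ) - 1) ^ 2 / n)) := by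
  obtain ⟨C, hC, hcap⟩ := lintegral_closedBall_enorm_le (𝕜 := 𝕜) hn
  refine ⟨C * 5 ^ (n - 1) * 8 * 8 ^ (((n : ℝ) - 1) ^ 2 / n), by positivity,
    fun Ω hΩ z δ hz hδ hδ1 => ?_⟩
  have hcap' := hcap Ω hΩ (direction z hz) (8 * δ) (by positivity) (by linarith)
  set a := (weakNorm (n : ℝ) (surfaceMeasure n) Ω).toReal with ha
  have ha0 : 0 ≤ a := ENNReal.toReal_nonneg
  set ρ := ‖z‖ with hρ
  have hρ0 : 0 < ρ := norm_pos_iff.2 hz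
  have hzd : z = ρ • (direction z hz : EuclideanSpace ℝ (Fin n)) := by
    simp [direction, smul_smul, hρ0.ne', ← hρ]
  set e := direction z hz
  have hB : MeasurableSet (closedBall z (4 * ρ * δ)) := measurableSet_closedBall
  calc ∫⁻ y in closedBall z (4 * ρ * δ), ‖homogeneousExt Ω y‖ₑ
      = ∫⁻ y, ‖homogeneousExt Ω y‖ₑ * (closedBall z (4 * ρ * δ)).indicator 1 y := by
        rw [← lintegral_indicator hB]
        refine lintegral_congr fun y => ?_
        by_cases hy : y ∈ closedBall z (4 * ρ * δ) <;> simp [hy]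
    _ = ∫⁻ θ, (‖Ω θ‖ₑ * ∫⁻ r in Ioi (0 : ℝ), ENNReal.ofReal (r ^ (n - 1)) *
          (closedBall z (4 * ρ * δ)).indicator 1 (r • (θ : EuclideanSpace ℝ (Fin n))))
          ∂(surfaceMeasure n) :=
        lintegral_homogeneousExt_mul hn hΩ.1 (measurable_one.indicator hB)
    _ ≤ ∫⁻ θ, (closedBall e (8 * δ)).indicator (fun θ => ‖Ω θ‖ₑ *
          ENNReal.ofReal ((5 * ρ) ^ (n - 1) * (8 * ρ * δ))) θ ∂(surfaceMeasure n) := by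
        refine lintegral_mono fun θ => ?_
        have hθ : ‖(θ : EuclideanSpace ℝ (Fin n))‖ = 1 := by simp
        have he : ‖(e : EuclideanSpace ℝ (Fin n))‖ = 1 := by simp
        -- If rθ is within 4ρδ of z = ρe, then |r - ρ| ≤ 4ρδ, and ρ|θ - e| ≤ |rθ - z| + |r - ρ| ≤
        -- 8ρδ. Hence the cap radius 8δ and the radial interval of length 8ρδ.
        have key : ∀ r : ℝ, 0 < r → r • (θ : EuclideanSpace ℝ (Fin n)) ∈ closedBall z (4 * ρ * δ) →
            |r - ρ| ≤ 4 * ρ * δ ∧ θ ∈ closedBall e (8 * δ) := by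
          intro r hr hmem
          rw [mem_closedBall, dist_eq_norm] at hmem
          have h1 : |r - ρ| ≤ 4 * ρ * δ := by
            refine le_trans ?_ hmem
            have := abs_norm_sub_norm_le (r • (θ : EuclideanSpace ℝ (Fin n))) z
            rwa [norm_smul, hθ, mul_one, Real.norm_eq_abs, abs_of_pos hr] at this
          refine ⟨h1, ?_⟩
          rw [mem_closedBall, Subtype.dist_eq, dist_eq_norm]
          have h2 : ρ * ‖(θ : EuclideanSpace ℝ (Fin n)) - e‖ ≤ ρ * (8 * δ) := by
            calc ρ * ‖(θ : EuclideanSpace ℝ (Fin n)) - e‖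
                = ‖(r • (θ : EuclideanSpace ℝ (Fin n)) - z) -
                    (r - ρ) • (θ : EuclideanSpace ℝ (Fin n))‖ := by
                  rw [← abs_of_pos hρ0, ← Real.norm_eq_abs, ← norm_smul, Real.norm_eq_abs,
                    abs_of_pos hρ0]
                  congr 1
                  rw [show r • (θ : EuclideanSpace ℝ (Fin n)) - z =
                    r • (θ : EuclideanSpace ℝ (Fin n)) - ρ • (e : EuclideanSpace ℝ (Fin n)) by
                      rw [← hzd]]
                  module
              _ ≤ 4 * ρ * δ + |r - ρ| := by
                  refine (norm_sub_le _ _).trans ?_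
                  rw [norm_smul (r - ρ), hθ, mul_one, Real.norm_eq_abs]
                  gcongr
              _ ≤ ρ * (8 * δ) := by linarith
          exact le_of_mul_le_mul_left h2 hρ0
        by_cases hmem : θ ∈ closedBall e (8 * δ)
        · rw [indicator_of_mem hmem]
          gcongr
          calc ∫⁻ r in Ioi (0 : ℝ), ENNReal.ofReal (r ^ (n - 1)) *
                (closedBall z (4 * ρ * δ)).indicator 1 (r • (θ : EuclideanSpace ℝ (Fin n)))
              ≤ ∫⁻ r in Ioi (0 : ℝ), (Icc (ρ - 4 * ρ * δ) (ρ + 4 * ρ * δ)).indicator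
                  (fun _ => ENNReal.ofReal ((5 * ρ) ^ (n - 1))) r := by
                refine setLIntegral_mono' measurableSet_Ioi fun r hr => ?_
                by_cases hm : r • (θ : EuclideanSpace ℝ (Fin n)) ∈ closedBall z (4 * ρ * δ)
                · have h1 := abs_le.1 (key r hr hm).1
                  rw [indicator_of_mem hm, Pi.one_apply, mul_one,
                    indicator_of_mem (mem_Icc.2 ⟨by linarith, by linarith⟩)]
                  have hr0 : 0 < r := hr
                  have : r ≤ 5 * ρ := by nlinarith
                  gcongr
                · rw [indicator_of_notMem hm, mul_zero]; exact zero_le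
            _ ≤ ∫⁻ r, (Icc (ρ - 4 * ρ * δ) (ρ + 4 * ρ * δ)).indicator
                  (fun _ => ENNReal.ofReal ((5 * ρ) ^ (n - 1))) r := setLIntegral_le_lintegral _ _
            _ = _ := by
                rw [lintegral_indicator_const measurableSet_Icc, Real.volume_Icc,
                  ENNReal.ofReal_mul (by positivity)]
                congr 2; ring
        · rw [indicator_of_notMem hmem]
          refine le_of_eq ?_
          rw [mul_eq_zero]; right
          rw [← lintegral_zero (μ := volume.restrict (Ioi (0 : ℝ)))]
          refine setLIntegral_congr_fun measurableSet_Ioi fun r hr => ?_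
          rw [indicator_of_notMem fun h => hmem (key r hr h).2, mul_zero]
    _ = (∫⁻ θ in closedBall e (8 * δ), ‖Ω θ‖ₑ ∂(surfaceMeasure n)) *
          ENNReal.ofReal ((5 * ρ) ^ (n - 1) * (8 * ρ * δ)) := by
        rw [lintegral_indicator measurableSet_closedBall, lintegral_mul_const' _ _ (by simp)]
    _ ≤ ENNReal.ofReal (C * a * (8 * δ) ^ (((n : ℝ) - 1) ^ 2 / n)) *
          ENNReal.ofReal ((5 * ρ) ^ (n - 1) * (8 * ρ * δ)) := by gcongr
    _ = _ := by
        rw [← ENNReal.ofReal_mul (by positivity), Real.mul_rpow (by norm_num) hδ.le]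
        congr 1
        obtain ⟨m, rfl⟩ : ∃ m, n = m + 1 := ⟨n - 1, by omega⟩
        rw [Nat.add_sub_cancel]
        ring

/-- Used with d = |y - z| to replace the singular factor by a constant on each dyadic shell around
z. The bound 3ρ is what |y| ≤ 2ρ and |z| = ρ give. -/
lemma exists_dyadic_layer {n : ℕ} {ρ d : ℝ} (hρ : 0 < ρ) (hd : 0 ≤ d) (hdρ : d ≤ 3 * ρ) :
    ∃ j : ℕ, d ≤ 4 * ρ * (1 / 2) ^ j ∧ (d ^ n)⁻¹ ≤ ((2 * ρ * (1 / 2) ^ j) ^ n)⁻¹ := by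
  -- At d = 0 with positive exponent, the left side is `0⁻¹ = 0`, so any layer serves.
  rcases hd.eq_or_lt with h0 | h0
  · refine ⟨0, by rw [← h0]; positivity, ?_⟩
    rcases Nat.eq_zero_or_pos n with rfl | hn
    · simp
    · rw [← h0, zero_pow hn.ne', inv_zero]; positivity
  · obtain ⟨j, h1, h2⟩ := exists_nat_pow_near_of_lt_one (x := d / (4 * ρ)) (y := 1 / 2)
      (by positivity) (by rw [div_le_one (by positivity)]; linarith) (by norm_num) (by norm_num)
    rw [lt_div_iff₀ (by positivity)] at h1
    rw [div_le_iff₀ (by positivity)] at h2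
    refine ⟨j, by linarith, ?_⟩
    have : 2 * ρ * (1 / 2) ^ j ≤ d := by rw [pow_succ] at h1; linarith
    gcongr

/-- On the shell of relative radius d = 2^(-j) around z, the cone estimate contributes d ·
d^((n-1)²/n) and the singularity contributes d^(1-n). The product is d^(1/n), so the shells form a
geometric series of ratio `q` = 2^(-1/n). -/
lemma lintegral_kernel_near_le (hn : 0 < n) {α : ℝ} (hαn : α < n) :
    ∃ C : ℝ, 0 < C ∧ ∀ Ω : sphere (0 : EuclideanSpace ℝ (Fin n)) 1 → 𝕜,
      MemWeakLp (n : ℝ) (surfaceMeasure n) Ω →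
      ∀ z : EuclideanSpace ℝ (Fin n), z ≠ 0 →
      ∫⁻ y in {y | ‖z‖ ≤ ‖y‖ ∧ ‖y‖ ≤ 2 * ‖z‖}, ‖homogeneousExt Ω y‖ₑ *
        ENNReal.ofReal ((‖y‖ ^ ((n : ℝ) + 1 - α))⁻¹ * (‖y - z‖ ^ (n - 1))⁻¹) ≤
        ENNReal.ofReal (C * (weakNorm (n : ℝ) (surfaceMeasure n) Ω).toReal *
          (‖z‖ ^ ((n : ℝ) - α))⁻¹) := by
  obtain ⟨C, hC, hball⟩ := lintegral_homogeneousExt_closedBall_le (𝕜 := 𝕜) hn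
  set q : ℝ := (1 / 2) ^ (1 / (n : ℝ)) with hq
  have hn0 : (0 : ℝ) < n := by positivity
  have hq0 : 0 < q := by positivity
  have hq1 : q < 1 := Real.rpow_lt_one (by norm_num) (by norm_num) (by positivity)
  refine ⟨C * (2 ^ (n - 1))⁻¹ * (1 - q)⁻¹, by have := sub_pos.2 hq1; positivity,
    fun Ω hΩ z hz => ?_⟩
  have hb := fun δ => hball Ω hΩ z δ hz
  set a := (weakNorm (n : ℝ) (surfaceMeasure n) Ω).toReal with ha
  have ha0 : 0 ≤ a := ENNReal.toReal_nonneg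
  set ρ := ‖z‖ with hρ
  have hρ0 : 0 < ρ := norm_pos_iff.2 hz
  have hms : MeasurableSet {y : EuclideanSpace ℝ (Fin n) | ρ ≤ ‖y‖ ∧ ‖y‖ ≤ 2 * ρ} :=
    (measurableSet_le measurable_const measurable_norm).inter
      (measurableSet_le measurable_norm measurable_const)
  have hom := (aestronglyMeasurable_homogeneousExt hn hΩ.1).enorm
  set c : ℕ → ℝ := fun j => (ρ ^ ((n : ℝ) + 1 - α))⁻¹ * ((2 * ρ * (1 / 2) ^ j) ^ (n - 1))⁻¹ with hc
  have hc0 : ∀ j, 0 ≤ c j := fun j => by positivity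
  calc _ ≤ ∫⁻ y in {y | ρ ≤ ‖y‖ ∧ ‖y‖ ≤ 2 * ρ}, ∑' j : ℕ,
          (closedBall z (4 * ρ * (1 / 2) ^ j)).indicator (fun y => ‖homogeneousExt Ω y‖ₑ) y *
            ENNReal.ofReal (c j) := by
        refine setLIntegral_mono' hms fun y hy => ?_
        have hd : ‖y - z‖ ≤ 3 * ρ := (norm_sub_le _ _).trans (by linarith [hy.2])
        obtain ⟨j, h1, h2⟩ := exists_dyadic_layer (n := n - 1) hρ0 (norm_nonneg (y - z)) hd
        refine le_trans ?_ (ENNReal.le_tsum j)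
        rw [indicator_of_mem (by rwa [mem_closedBall, dist_eq_norm])]
        have h3 : (‖y‖ ^ ((n : ℝ) + 1 - α))⁻¹ ≤ (ρ ^ ((n : ℝ) + 1 - α))⁻¹ := by
          have := hy.1
          gcongr
          linarith
        gcongr
        exact mul_le_mul h3 h2 (by positivity) (by positivity)
    _ ≤ ∫⁻ y, ∑' j : ℕ,
          (closedBall z (4 * ρ * (1 / 2) ^ j)).indicator (fun y => ‖homogeneousExt Ω y‖ₑ) y *
            ENNReal.ofReal (c j) := setLIntegral_le_lintegral _ _
    _ = ∑' j : ℕ, (∫⁻ y in closedBall z (4 * ρ * (1 / 2) ^ j), ‖homogeneousExt Ω y‖ₑ) *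
            ENNReal.ofReal (c j) := by
        rw [lintegral_tsum fun j => (hom.indicator measurableSet_closedBall).mul_const _]
        congr 1
        funext j
        rw [lintegral_mul_const' _ _ (by simp), lintegral_indicator measurableSet_closedBall]
    _ ≤ ∑' j : ℕ, ENNReal.ofReal (C * (2 ^ (n - 1))⁻¹ * a * (ρ ^ ((n : ℝ) - α))⁻¹ * q ^ j) := by
        refine ENNReal.tsum_le_tsum fun j => ?_
        set d : ℝ := (1 / 2) ^ j with hd
        have hd0 : 0 < d := by positivity
        have hd1 : d ≤ 1 := pow_le_one₀ (by norm_num) (by norm_num)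
        refine (mul_le_mul_left (hb d hd0 hd1) _).trans (le_of_eq ?_)
        rw [← ENNReal.ofReal_mul (by positivity)]
        congr 1
        -- The exponent count: 1 + (n-1)²/n = 1/n + (n-1).
        have e1 : d * d ^ (((n : ℝ) - 1) ^ 2 / n) = q ^ j * d ^ (n - 1) := by
          have : q ^ j = d ^ (1 / (n : ℝ)) := by
            rw [hq, hd, ← Real.rpow_natCast, ← Real.rpow_natCast, ← Real.rpow_mul (by norm_num),
              ← Real.rpow_mul (by norm_num), mul_comm]
          rw [this, ← Real.rpow_natCast d (n - 1), Nat.cast_sub hn, Nat.cast_one,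
            ← Real.rpow_add hd0]
          nth_rewrite 1 [← Real.rpow_one d]
          rw [← Real.rpow_add hd0]
          congr 1; field_simp; ring
        have e2 : ρ ^ n = ρ ^ ((n : ℝ) + 1 - α) * ρ ^ (n - 1) * (ρ ^ ((n : ℝ) - α))⁻¹ := by
          rw [← Real.rpow_neg hρ0.le, ← Real.rpow_natCast ρ n, ← Real.rpow_natCast ρ (n - 1),
            Nat.cast_sub hn, Nat.cast_one, ← Real.rpow_add hρ0, ← Real.rpow_add hρ0]
          congr 1; ring
        rw [mul_assoc _ d, e1, e2, hc]
        simp only [mul_pow]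
        rw [← hd]
        have : ρ ^ ((n : ℝ) + 1 - α) ≠ 0 := by positivity
        field_simp
    _ = _ := by
        rw [← ENNReal.ofReal_tsum_of_nonneg (fun j => by positivity)
          ((summable_geometric_of_lt_one hq0.le hq1).mul_left _), tsum_mul_left,
          tsum_geometric_of_lt_one hq0.le hq1]
        congr 1; ring

/-- Here |y - z| ≥ |y|/2, so the kernel is at most a multiple of |Ω| |y|^(-(2n-α)). Its radial
integral converges at infinity because α < n, and on the sphere only the L¹ norm of Ω is needed,
which is the cap estimate at radius 8. -/
lemma lintegral_kernel_far_le (hn : 0 < n) {α : ℝ} (hαn : α < n) :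
    ∃ C : ℝ, 0 < C ∧ ∀ Ω : sphere (0 : EuclideanSpace ℝ (Fin n)) 1 → 𝕜,
      MemWeakLp (n : ℝ) (surfaceMeasure n) Ω →
      ∀ z : EuclideanSpace ℝ (Fin n), z ≠ 0 →
      ∫⁻ y in {y | 2 * ‖z‖ < ‖y‖}, ‖homogeneousExt Ω y‖ₑ *
        ENNReal.ofReal ((‖y‖ ^ ((n : ℝ) + 1 - α))⁻¹ * (‖y - z‖ ^ (n - 1))⁻¹) ≤
        ENNReal.ofReal (C * (weakNorm (n : ℝ) (surfaceMeasure n) Ω).toReal *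
          (‖z‖ ^ ((n : ℝ) - α))⁻¹) := by
  obtain ⟨C, hC, hcap⟩ := lintegral_closedBall_enorm_le (𝕜 := 𝕜) hn
  have hnα : 0 < (n : ℝ) - α := by linarith
  refine ⟨C * 8 ^ (((n : ℝ) - 1) ^ 2 / n) * (2 ^ (n - 1) * (1 / ((n : ℝ) - α))), by positivity,
    fun Ω hΩ z hz => ?_⟩
  have hcap' := hcap Ω hΩ (direction z hz) 8 (by positivity) le_rfl
  have huniv : closedBall (direction z hz) 8 = univ := by
    refine eq_univ_of_forall fun θ => ?_
    rw [mem_closedBall, Subtype.dist_eq, dist_eq_norm]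
    refine (norm_sub_le _ _).trans ?_
    simp; norm_num
  rw [huniv, Measure.restrict_univ] at hcap'
  set a := (weakNorm (n : ℝ) (surfaceMeasure n) Ω).toReal with ha
  have ha0 : 0 ≤ a := ENNReal.toReal_nonneg
  set ρ := ‖z‖ with hρ
  have hρ0 : 0 < ρ := norm_pos_iff.2 hz
  have hms : MeasurableSet {y : EuclideanSpace ℝ (Fin n) | 2 * ρ < ‖y‖} :=
    measurableSet_lt measurable_const measurable_norm
  set H : EuclideanSpace ℝ (Fin n) → ℝ≥0∞ := {y | ρ < ‖y‖}.indicator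
    (fun y => ENNReal.ofReal (2 ^ (n - 1) * ‖y‖ ^ (-(2 * (n : ℝ) - α)))) with hH
  have hHm : Measurable H :=
    Measurable.indicator (by fun_prop) (measurableSet_lt measurable_const measurable_norm)
  calc _ ≤ ∫⁻ y in {y | 2 * ρ < ‖y‖}, ‖homogeneousExt Ω y‖ₑ * H y := by
        refine setLIntegral_mono' hms fun y hy => ?_
        have hy' : 2 * ρ < ‖y‖ := hy
        have hy0 : 0 < ‖y‖ := by linarith
        gcongr
        rw [hH, indicator_of_mem (show y ∈ {y | ρ < ‖y‖} from by
          rw [mem_ofPred_eq]; linarith)]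
        apply ENNReal.ofReal_le_ofReal
        have h1 : ‖y‖ / 2 ≤ ‖y - z‖ := by
          have := norm_sub_norm_le y z
          linarith
        have h2 : (‖y - z‖ ^ (n - 1))⁻¹ ≤ ((‖y‖ / 2) ^ (n - 1))⁻¹ := by gcongr
        calc _ ≤ (‖y‖ ^ ((n : ℝ) + 1 - α))⁻¹ * ((‖y‖ / 2) ^ (n - 1))⁻¹ := by gcongr
          _ = _ := by
            rw [div_pow, inv_div, ← Real.rpow_neg hy0.le, div_eq_mul_inv, ← Real.rpow_natCast ‖y‖,
              ← Real.rpow_neg hy0.le, Nat.cast_sub hn, Nat.cast_one,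
              mul_left_comm, ← Real.rpow_add hy0]
            congr 2; ring
    _ ≤ ∫⁻ y, ‖homogeneousExt Ω y‖ₑ * H y := setLIntegral_le_lintegral _ _
    _ = ∫⁻ θ, (‖Ω θ‖ₑ * ∫⁻ r in Ioi (0 : ℝ), ENNReal.ofReal (r ^ (n - 1)) *
          H (r • (θ : EuclideanSpace ℝ (Fin n)))) ∂(surfaceMeasure n) :=
        lintegral_homogeneousExt_mul hn hΩ.1 hHm
    _ = ∫⁻ θ, (‖Ω θ‖ₑ * ENNReal.ofReal
          (2 ^ (n - 1) * (1 / ((n : ℝ) - α)) * (ρ ^ ((n : ℝ) - α))⁻¹)) ∂(surfaceMeasure n) := by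
        refine lintegral_congr fun θ => ?_
        congr 1
        have hθ : ‖(θ : EuclideanSpace ℝ (Fin n))‖ = 1 := by simp
        have hint := (integrableOn_Ioi_rpow_of_lt (a := -((n : ℝ) - α) - 1)
          (by linarith) hρ0).const_mul (2 ^ (n - 1))
        calc ∫⁻ r in Ioi (0 : ℝ), ENNReal.ofReal (r ^ (n - 1)) *
              H (r • (θ : EuclideanSpace ℝ (Fin n)))
            = ∫⁻ r in Ioi (0 : ℝ), (Ioi ρ).indicator
                (fun r => ENNReal.ofReal (2 ^ (n - 1) * r ^ (-((n : ℝ) - α) - 1))) r := by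
              refine setLIntegral_congr_fun measurableSet_Ioi fun r hr => ?_
              have hr0 : 0 < r := hr
              simp only [hH]
              have hnr : ‖r • (θ : EuclideanSpace ℝ (Fin n))‖ = r := by
                rw [norm_smul, hθ, mul_one, Real.norm_eq_abs, abs_of_pos hr0]
              by_cases h : ρ < r
              · rw [indicator_of_mem (by simpa [hnr] using h), indicator_of_mem (by simpa using h),
                  ← ENNReal.ofReal_mul (by positivity), hnr]
                congr 1
                rw [mul_left_comm, ← Real.rpow_natCast r, ← Real.rpow_add hr0, Nat.cast_sub hn]
                congr 2; push_cast; ring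
              · rw [indicator_of_notMem (by simpa [hnr] using h),
                  indicator_of_notMem (by simpa using h), mul_zero]
          _ = ∫⁻ r in Ioi ρ, ENNReal.ofReal (2 ^ (n - 1) * r ^ (-((n : ℝ) - α) - 1)) := by
              rw [lintegral_indicator measurableSet_Ioi, Measure.restrict_restrict measurableSet_Ioi,
                inter_eq_left.2 (Ioi_subset_Ioi hρ0.le)]
          _ = ENNReal.ofReal (∫ r in Ioi ρ, 2 ^ (n - 1) * r ^ (-((n : ℝ) - α) - 1)) := by
              rw [ofReal_integral_eq_lintegral_ofReal hint]
              filter_upwards [ae_restrict_mem measurableSet_Ioi] with t ht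
              have : 0 < t := hρ0.trans ht
              positivity
          _ = _ := by
              rw [integral_const_mul, integral_Ioi_rpow_of_lt (by linarith) hρ0, sub_add_cancel,
                neg_div_neg_eq, Real.rpow_neg hρ0.le]
              congr 1; ring
    _ = (∫⁻ θ, ‖Ω θ‖ₑ ∂(surfaceMeasure n)) * ENNReal.ofReal
          (2 ^ (n - 1) * (1 / ((n : ℝ) - α)) * (ρ ^ ((n : ℝ) - α))⁻¹) :=
        lintegral_mul_const' _ _ (by simp)
    _ ≤ ENNReal.ofReal (C * a * 8 ^ (((n : ℝ) - 1) ^ 2 / n)) * ENNReal.ofReal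
          (2 ^ (n - 1) * (1 / ((n : ℝ) - α)) * (ρ ^ ((n : ℝ) - α))⁻¹) := by gcongr
    _ = _ := by
        rw [← ENNReal.ofReal_mul (by positivity)]
        congr 1; ring

/-- The rough kernel integrated against `|y - z|^{1-n}` outside the ball of radius `|z|`. -/
lemma lintegral_kernel_le (hn : 0 < n) {α : ℝ} (hαn : α < n) :
    ∃ C : ℝ, 0 < C ∧ ∀ Ω : sphere (0 : EuclideanSpace ℝ (Fin n)) 1 → 𝕜,
      MemWeakLp (n : ℝ) (surfaceMeasure n) Ω →
      ∀ z : EuclideanSpace ℝ (Fin n), z ≠ 0 →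
      ∫⁻ y in {y | ‖z‖ ≤ ‖y‖}, ‖homogeneousExt Ω y‖ₑ *
        ENNReal.ofReal ((‖y‖ ^ ((n : ℝ) + 1 - α))⁻¹ * (‖y - z‖ ^ (n - 1))⁻¹) ≤
        ENNReal.ofReal (C * (weakNorm (n : ℝ) (surfaceMeasure n) Ω).toReal *
          (‖z‖ ^ ((n : ℝ) - α))⁻¹) := by
  obtain ⟨C₁, hC₁, h₁⟩ := lintegral_kernel_near_le (𝕜 := 𝕜) hn hαn
  obtain ⟨C₂, hC₂, h₂⟩ := lintegral_kernel_far_le (𝕜 := 𝕜) hn hαn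
  refine ⟨C₁ + C₂, by positivity, fun Ω hΩ z hz => ?_⟩
  have hsub : {y : EuclideanSpace ℝ (Fin n) | ‖z‖ ≤ ‖y‖} ⊆
      {y | ‖z‖ ≤ ‖y‖ ∧ ‖y‖ ≤ 2 * ‖z‖} ∪ {y | 2 * ‖z‖ < ‖y‖} := fun y hy =>
    (le_or_gt ‖y‖ (2 * ‖z‖)).imp (fun h => ⟨hy, h⟩) id
  refine (lintegral_mono_set hsub).trans ((lintegral_union_le _ _ _).trans
    ((add_le_add (h₁ Ω hΩ z hz) (h₂ Ω hΩ z hz)).trans (le_of_eq ?_)))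
  have := ENNReal.toReal_nonneg (a := weakNorm (n : ℝ) (surfaceMeasure n) Ω)
  rw [← ENNReal.ofReal_add (by positivity) (by positivity)]
  congr 1; ring

end Kernel

/-! ### Pointwise Poincaré inequality and Tonelli -/

section Poincare

variable {n : ℕ} {𝕜 : Type*} [RCLike 𝕜]

/-- `G` dominates the oscillation of `g` along every segment. -/
def IsUpperGradient (G : EuclideanSpace ℝ (Fin n) → ℝ≥0∞) (g : EuclideanSpace ℝ (Fin n) → 𝕜) :
    Prop :=
  ∀ (y : EuclideanSpace ℝ (Fin n)) (θ : sphere (0 : EuclideanSpace ℝ (Fin n)) 1) (r : ℝ), 0 < r →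
    ‖g y - g (y + r • (θ : EuclideanSpace ℝ (Fin n)))‖ₑ ≤
      ∫⁻ s in Ioc 0 r, G (y + s • (θ : EuclideanSpace ℝ (Fin n)))

/-- In polar coordinates about y, the oscillation along each ray is at most the integral of G over
the segment, which stays in the ball by convexity. Since r ≤ 2R, integrating r^(n-1) costs at most
(2R)^n. Reading the ray integrals of G back as a volume integral produces the weight |y - z|^(1-n).
-/
lemma lintegral_enorm_sub_le (hn : 0 < n) {g : EuclideanSpace ℝ (Fin n) → 𝕜}
    {G : EuclideanSpace ℝ (Fin n) → ℝ≥0∞} (hg : Continuous g) (hG : Measurable G)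
    (hgG : IsUpperGradient G g) {R : ℝ} (hR : 0 < R) {y : EuclideanSpace ℝ (Fin n)}
    (hy : y ∈ closedBall (0 : EuclideanSpace ℝ (Fin n)) R) :
    ∫⁻ w in closedBall 0 R, ‖g y - g w‖ₑ ≤ ENNReal.ofReal ((2 * R) ^ n) *
      ∫⁻ z in closedBall 0 R, G z * ENNReal.ofReal ((‖y - z‖ ^ (n - 1))⁻¹) := by
  set B := closedBall (0 : EuclideanSpace ℝ (Fin n)) R with hB
  have hBm : MeasurableSet B := measurableSet_closedBall
  have hconv : Convex ℝ B := convex_closedBall _ _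
  set Φ : sphere (0 : EuclideanSpace ℝ (Fin n)) 1 → ℝ≥0∞ :=
    fun θ => ∫⁻ s in Ioi (0 : ℝ), B.indicator G (y + s • (θ : EuclideanSpace ℝ (Fin n))) with hΦ
  have hGB : Measurable (B.indicator G) := hG.indicator hBm
  have hpt : ∀ (θ : sphere (0 : EuclideanSpace ℝ (Fin n)) 1) (r : ℝ), 0 < r →
      ENNReal.ofReal (r ^ (n - 1)) * B.indicator (fun w => ‖g y - g w‖ₑ)
        (y + r • (θ : EuclideanSpace ℝ (Fin n))) ≤
      (Ioc 0 (2 * R)).indicator (fun _ => ENNReal.ofReal ((2 * R) ^ (n - 1)) * Φ θ) r := by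
    intro θ r hr
    have hθ : ‖(θ : EuclideanSpace ℝ (Fin n))‖ = 1 := by simp
    by_cases hmem : y + r • (θ : EuclideanSpace ℝ (Fin n)) ∈ B
    · have hrR : r ≤ 2 * R := by
        have h1 : ‖r • (θ : EuclideanSpace ℝ (Fin n))‖ = r := by
          rw [norm_smul, hθ, mul_one, Real.norm_eq_abs, abs_of_pos hr]
        have h2 := norm_sub_le (y + r • (θ : EuclideanSpace ℝ (Fin n))) y
        rw [add_sub_cancel_left, h1] at h2
        rw [hB, mem_closedBall_zero_iff] at hy hmem
        linarith
      rw [indicator_of_mem hmem, indicator_of_mem (mem_Ioc.2 ⟨hr, hrR⟩)]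
      gcongr
      refine (hgG y θ r hr).trans ?_
      calc ∫⁻ s in Ioc 0 r, G (y + s • (θ : EuclideanSpace ℝ (Fin n)))
          = ∫⁻ s in Ioc 0 r, B.indicator G (y + s • (θ : EuclideanSpace ℝ (Fin n))) := by
            refine setLIntegral_congr_fun measurableSet_Ioc fun s hs => ?_
            rw [indicator_of_mem]
            have := hconv.add_smul_mem hy hmem (t := s / r)
              ⟨by have := hs.1; positivity, (div_le_one hr).2 hs.2⟩
            rwa [smul_smul, div_mul_cancel₀ _ hr.ne'] at this
        _ ≤ _ := lintegral_mono_set Ioc_subset_Ioi_self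
    · rw [indicator_of_notMem hmem, mul_zero]; exact zero_le
  calc ∫⁻ w in B, ‖g y - g w‖ₑ = ∫⁻ w, B.indicator (fun w => ‖g y - g w‖ₑ) w :=
        (lintegral_indicator hBm _).symm
    _ = ∫⁻ u, B.indicator (fun w => ‖g y - g w‖ₑ) (y + u) :=
        (lintegral_add_left_eq_self _ y).symm
    _ = ∫⁻ θ, (∫⁻ r in Ioi (0 : ℝ), ENNReal.ofReal (r ^ (n - 1)) *
          B.indicator (fun w => ‖g y - g w‖ₑ) (y + r • (θ : EuclideanSpace ℝ (Fin n))))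
          ∂(surfaceMeasure n) := by
        refine lintegral_polar hn (Measurable.aemeasurable ?_)
        exact ((by fun_prop : Measurable fun w => ‖g y - g w‖ₑ).indicator hBm).comp
          (measurable_const_add y)
    _ ≤ ∫⁻ θ, (∫⁻ r, (Ioc 0 (2 * R)).indicator
          (fun _ => ENNReal.ofReal ((2 * R) ^ (n - 1)) * Φ θ) r) ∂(surfaceMeasure n) := by
        refine lintegral_mono fun θ => ?_
        exact (setLIntegral_mono' measurableSet_Ioi fun r hr => hpt θ r hr).trans
          (setLIntegral_le_lintegral _ _)
    _ = ∫⁻ θ, ENNReal.ofReal ((2 * R) ^ n) * Φ θ ∂(surfaceMeasure n) := by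
        refine lintegral_congr fun θ => ?_
        rw [lintegral_indicator_const measurableSet_Ioc, Real.volume_Ioc, sub_zero, mul_right_comm,
          ← ENNReal.ofReal_mul (by positivity), ← pow_succ, Nat.sub_add_cancel hn]
    _ = ENNReal.ofReal ((2 * R) ^ n) * ∫⁻ θ, Φ θ ∂(surfaceMeasure n) :=
        lintegral_const_mul' _ _ (by simp)
    _ = ENNReal.ofReal ((2 * R) ^ n) *
          ∫⁻ u, B.indicator G (y + u) * ENNReal.ofReal ((‖u‖ ^ (n - 1))⁻¹) := by
        congr 1
        rw [lintegral_polar (F := fun u => B.indicator G (y + u) *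
          ENNReal.ofReal ((‖u‖ ^ (n - 1))⁻¹)) hn (by fun_prop)]
        refine lintegral_congr fun θ => ?_
        refine setLIntegral_congr_fun measurableSet_Ioi fun r hr => ?_
        have hr0 : 0 < r := hr
        have hθ : ‖(θ : EuclideanSpace ℝ (Fin n))‖ = 1 := by simp
        rw [norm_smul, hθ, mul_one, Real.norm_eq_abs, abs_of_pos hr0, mul_left_comm,
          ← ENNReal.ofReal_mul (by positivity), mul_inv_cancel₀ (by positivity), ENNReal.ofReal_one,
          mul_one]
    _ = ENNReal.ofReal ((2 * R) ^ n) *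
          ∫⁻ z, B.indicator G z * ENNReal.ofReal ((‖y - z‖ ^ (n - 1))⁻¹) := by
        congr 1
        rw [← lintegral_add_left_eq_self (fun z => B.indicator G z *
          ENNReal.ofReal ((‖y - z‖ ^ (n - 1))⁻¹)) y]
        simp
    _ = _ := by
        congr 1
        rw [← lintegral_indicator hBm]
        refine lintegral_congr fun z => ?_
        rw [indicator_mul_left]

lemma volume_closedBall_zero (n : ℕ) {R : ℝ} (hR : 0 ≤ R) :
    volume (closedBall (0 : EuclideanSpace ℝ (Fin n)) R) =
      ENNReal.ofReal (R ^ n * (volume : Measure (EuclideanSpace ℝ (Fin n))).real (ball 0 1)) := by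
  rw [Measure.addHaar_closedBall _ _ hR, ENNReal.ofReal_mul (by positivity), ofReal_measureReal,
    finrank_euclideanSpace_fin]

lemma volume_real_ball_pos (n : ℕ) :
    0 < (volume : Measure (EuclideanSpace ℝ (Fin n))).real (ball 0 1) := by
  rw [measureReal_def]
  exact ENNReal.toReal_pos (isOpen_ball.measure_ne_zero _ (by simp)) measure_ball_lt_top.ne

/-- The average of `g` over the ball of radius `R` about the origin. -/
noncomputable def ballAverage (g : EuclideanSpace ℝ (Fin n) → 𝕜) (R : ℝ) : 𝕜 :=
  ⨍ w in closedBall (0 : EuclideanSpace ℝ (Fin n)) R, g w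

/-- The domain of integration depends on y, so the mean is rewritten as a parametric integral of one
jointly measurable function cut off to |w| ≤ |y|. -/
lemma stronglyMeasurable_ballAverage_norm {g : EuclideanSpace ℝ (Fin n) → 𝕜} (hg : Continuous g) :
    StronglyMeasurable fun y : EuclideanSpace ℝ (Fin n) => ballAverage g ‖y‖ := by
  have h1 : (fun y : EuclideanSpace ℝ (Fin n) => ballAverage g ‖y‖) = fun y =>
      (‖y‖ ^ n * (volume : Measure (EuclideanSpace ℝ (Fin n))).real (ball 0 1))⁻¹ •
        ∫ w, {p : EuclideanSpace ℝ (Fin n) × EuclideanSpace ℝ (Fin n) | ‖p.2‖ ≤ ‖p.1‖}.indicator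
          (fun p => g p.2) (y, w) := by
    funext y
    rw [ballAverage, setAverage_eq, measureReal_def, volume_closedBall_zero n (norm_nonneg y),
      ENNReal.toReal_ofReal (by positivity), ← integral_indicator measurableSet_closedBall]
    congr 2
    funext w
    by_cases h : ‖w‖ ≤ ‖y‖ <;> simp [indicator, h]
  rw [h1]
  refine StronglyMeasurable.smul (by fun_prop : Measurable _).stronglyMeasurable ?_
  refine StronglyMeasurable.integral_prod_right' (f := fun p : EuclideanSpace ℝ (Fin n) ×
    EuclideanSpace ℝ (Fin n) => {p : EuclideanSpace ℝ (Fin n) × EuclideanSpace ℝ (Fin n) |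
      ‖p.2‖ ≤ ‖p.1‖}.indicator (fun p => g p.2) p) ?_
  exact (hg.comp continuous_snd).stronglyMeasurable.indicator
    (measurableSet_le (by fun_prop) (by fun_prop))

/-- Pointwise Poincaré inequality on balls. -/
lemma enorm_sub_ballAverage_le (hn : 0 < n) {g : EuclideanSpace ℝ (Fin n) → 𝕜}
    {G : EuclideanSpace ℝ (Fin n) → ℝ≥0∞} (hg : Continuous g) (hG : Measurable G)
    (hgG : IsUpperGradient G g) {y : EuclideanSpace ℝ (Fin n)} (hy : y ≠ 0) :
    ‖g y - ballAverage g ‖y‖‖ₑ ≤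
      ENNReal.ofReal (2 ^ n / (volume : Measure (EuclideanSpace ℝ (Fin n))).real (ball 0 1)) *
      ∫⁻ z in closedBall 0 ‖y‖, G z * ENNReal.ofReal ((‖y - z‖ ^ (n - 1))⁻¹) := by
  set R := ‖y‖ with hR
  have hR0 : 0 < R := norm_pos_iff.2 hy
  set v := (volume : Measure (EuclideanSpace ℝ (Fin n))).real (ball 0 1) with hv
  have hv0 : 0 < v := volume_real_ball_pos n
  set B := closedBall (0 : EuclideanSpace ℝ (Fin n)) R with hB
  have hvol : volume B = ENNReal.ofReal (R ^ n * v) := volume_closedBall_zero n hR0.le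
  have hvolr : (volume : Measure (EuclideanSpace ℝ (Fin n))).real B = R ^ n * v := by
    rw [measureReal_def, hvol, ENNReal.toReal_ofReal (by positivity)]
  have hint : IntegrableOn g B := hg.continuousOn.integrableOn_compact (isCompact_closedBall _ _)
  have hconst : IntegrableOn (fun _ => g y) B := by
    refine integrableOn_const ?_
    rw [hvol]; exact ENNReal.ofReal_ne_top
  have h1 : g y - ballAverage g R = (R ^ n * v)⁻¹ • ∫ w in B, (g y - g w) := by
    rw [ballAverage, setAverage_eq, integral_sub hconst hint, setIntegral_const, hvolr, smul_sub,
      smul_smul, inv_mul_cancel₀ (by positivity), one_smul]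
  rw [h1, enorm_smul]
  calc ‖(R ^ n * v)⁻¹‖ₑ * ‖∫ w in B, (g y - g w)‖ₑ
      ≤ ENNReal.ofReal (R ^ n * v)⁻¹ * (ENNReal.ofReal ((2 * R) ^ n) *
          ∫⁻ z in B, G z * ENNReal.ofReal ((‖y - z‖ ^ (n - 1))⁻¹)) := by
        rw [Real.enorm_of_nonneg (by positivity)]
        gcongr
        exact (enorm_integral_le_lintegral_enorm _).trans
          (lintegral_enorm_sub_le hn hg hG hgG hR0 (by simp [hR]))
    _ = _ := by
        rw [← mul_assoc, ← ENNReal.ofReal_mul (by positivity), mul_pow]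
        congr 2
        field_simp

/-- The rough kernel integrated against the deviation of a function from its radial averages. -/
lemma lintegral_kernel_mul_sub_ballAverage_le (hn : 0 < n) {α : ℝ} (hαn : α < n) :
    ∃ C : ℝ, 0 < C ∧ ∀ Ω : sphere (0 : EuclideanSpace ℝ (Fin n)) 1 → 𝕜,
      MemWeakLp (n : ℝ) (surfaceMeasure n) Ω →
      ∀ (g : EuclideanSpace ℝ (Fin n) → 𝕜) (G : EuclideanSpace ℝ (Fin n) → ℝ≥0∞),
        Continuous g → Measurable G → IsUpperGradient G g →
      ∫⁻ y, ‖(‖y‖ ^ ((n : ℝ) + 1 - α))⁻¹ •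
          (homogeneousExt Ω y * (g y - ballAverage g ‖y‖))‖ₑ ≤
        ENNReal.ofReal (C * (weakNorm (n : ℝ) (surfaceMeasure n) Ω).toReal) *
          ∫⁻ z, G z * ENNReal.ofReal ((‖z‖ ^ ((n : ℝ) - α))⁻¹) := by
  obtain ⟨C, hC, hker⟩ := lintegral_kernel_le (𝕜 := 𝕜) hn hαn
  have : Nonempty (Fin n) := ⟨⟨0, hn⟩⟩
  set v := (volume : Measure (EuclideanSpace ℝ (Fin n))).real (ball 0 1) with hv
  have hv0 : 0 < v := volume_real_ball_pos n
  refine ⟨2 ^ n / v * C, by positivity, fun Ω hΩ g G hg hG hgG => ?_⟩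
  have hker' := hker Ω hΩ
  set a := (weakNorm (n : ℝ) (surfaceMeasure n) Ω).toReal with ha
  have ha0 : 0 ≤ a := ENNReal.toReal_nonneg
  have hom := (aestronglyMeasurable_homogeneousExt hn hΩ.1).enorm
  have hne : ∀ᵐ y : EuclideanSpace ℝ (Fin n), y ≠ 0 := by
    rw [ae_iff]; simp
  -- The cutoff |z| ≤ |y| is built into the kernel, so exchanging the integrals turns the ball in z
  -- into the exterior region |y| ≥ |z| of `lintegral_kernel_le`.
  set k : EuclideanSpace ℝ (Fin n) → EuclideanSpace ℝ (Fin n) → ℝ≥0∞ := fun y z =>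
    ‖homogeneousExt Ω y‖ₑ * {p : EuclideanSpace ℝ (Fin n) × EuclideanSpace ℝ (Fin n) |
      ‖p.2‖ ≤ ‖p.1‖}.indicator (fun p => G p.2 *
        ENNReal.ofReal ((‖p.1‖ ^ ((n : ℝ) + 1 - α))⁻¹ * (‖p.1 - p.2‖ ^ (n - 1))⁻¹)) (y, z) with hk
  have hkm : AEMeasurable (Function.uncurry k) (volume.prod volume) := by
    refine AEMeasurable.mul (f := fun p : EuclideanSpace ℝ (Fin n) × EuclideanSpace ℝ (Fin n) =>
      ‖homogeneousExt Ω p.1‖ₑ) (hom.comp_fst) (Measurable.aemeasurable ?_)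
    refine Measurable.indicator (by fun_prop) (measurableSet_le (by fun_prop) (by fun_prop))
  calc _ ≤ ∫⁻ y, ENNReal.ofReal (2 ^ n / v) * ∫⁻ z, k y z := by
        refine lintegral_mono_ae ?_
        filter_upwards [hne] with y hy
        rw [enorm_smul, enorm_mul, Real.enorm_of_nonneg (by positivity)]
        have hp := enorm_sub_ballAverage_le hn hg hG hgG hy
        calc _ ≤ ENNReal.ofReal (‖y‖ ^ ((n : ℝ) + 1 - α))⁻¹ * (‖homogeneousExt Ω y‖ₑ *
              (ENNReal.ofReal (2 ^ n / v) * ∫⁻ z in closedBall 0 ‖y‖, G z *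
                ENNReal.ofReal ((‖y - z‖ ^ (n - 1))⁻¹))) := by gcongr
          _ = ENNReal.ofReal (2 ^ n / v) * (‖homogeneousExt Ω y‖ₑ *
              (ENNReal.ofReal (‖y‖ ^ ((n : ℝ) + 1 - α))⁻¹ * ∫⁻ z in closedBall 0 ‖y‖, G z *
                ENNReal.ofReal ((‖y - z‖ ^ (n - 1))⁻¹))) := by ring
          _ = _ := by
            congr 1
            simp only [hk]
            rw [← lintegral_const_mul' _ _ (by simp), ← lintegral_const_mul' _ _ (by simp),
              ← lintegral_indicator measurableSet_closedBall,
              lintegral_const_mul' _ _ (by simp)]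
            rw [← lintegral_const_mul' _ _ (by simp)]
            refine lintegral_congr fun z => ?_
            by_cases h : ‖z‖ ≤ ‖y‖
            · rw [indicator_of_mem (by simpa using h), indicator_of_mem (by simpa using h),
                ENNReal.ofReal_mul (by positivity)]
              ring
            · rw [indicator_of_notMem (by simpa using h), indicator_of_notMem (by simpa using h),
                mul_zero]
    _ = ENNReal.ofReal (2 ^ n / v) * ∫⁻ z, ∫⁻ y, k y z := by
        rw [lintegral_const_mul' _ _ (by simp), lintegral_lintegral_swap hkm]
    _ ≤ ENNReal.ofReal (2 ^ n / v) * ∫⁻ z, ENNReal.ofReal (C * a) *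
          (G z * ENNReal.ofReal ((‖z‖ ^ ((n : ℝ) - α))⁻¹)) := by
        refine mul_le_mul' le_rfl (lintegral_mono_ae ?_)
        filter_upwards [hne] with z hz
        have hms : MeasurableSet {y : EuclideanSpace ℝ (Fin n) | ‖z‖ ≤ ‖y‖} :=
          measurableSet_le measurable_const measurable_norm
        calc ∫⁻ y, k y z = ∫⁻ y, G z * {y : EuclideanSpace ℝ (Fin n) | ‖z‖ ≤ ‖y‖}.indicator
              (fun y => ‖homogeneousExt Ω y‖ₑ *
                ENNReal.ofReal ((‖y‖ ^ ((n : ℝ) + 1 - α))⁻¹ * (‖y - z‖ ^ (n - 1))⁻¹)) y := by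
              refine lintegral_congr fun y => ?_
              simp only [hk]
              by_cases h : ‖z‖ ≤ ‖y‖
              · rw [indicator_of_mem (by simpa using h), indicator_of_mem (by simpa using h)]
                ring
              · rw [indicator_of_notMem (by simpa using h), indicator_of_notMem (by simpa using h),
                  mul_zero, mul_zero]
          _ = G z * ∫⁻ y in {y | ‖z‖ ≤ ‖y‖}, ‖homogeneousExt Ω y‖ₑ *
                ENNReal.ofReal ((‖y‖ ^ ((n : ℝ) + 1 - α))⁻¹ * (‖y - z‖ ^ (n - 1))⁻¹) := by
              rw [lintegral_const_mul'', lintegral_indicator hms]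
              refine AEMeasurable.indicator (hom.mul (by fun_prop)) hms
          _ ≤ G z * ENNReal.ofReal (C * a * (‖z‖ ^ ((n : ℝ) - α))⁻¹) := by
              gcongr; exact hker' z hz
          _ = _ := by rw [ENNReal.ofReal_mul (by positivity)]; ring
    _ = _ := by
        rw [lintegral_const_mul' _ _ (by simp), ← mul_assoc, ← ENNReal.ofReal_mul (by positivity)]
        congr 2; ring

end Poincare

/-! ### Existence of the principal value and the Riesz bound -/

section PrincipalValue

variable {n : ℕ} {𝕜 : Type*} [RCLike 𝕜]

lemma gradNorm_nonneg (f : EuclideanSpace ℝ (Fin n) → 𝕜) (x : EuclideanSpace ℝ (Fin n)) :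
    0 ≤ gradNorm f x := Real.sqrt_nonneg _

/-- Cauchy–Schwarz in coordinates; the derivative is real-linear also for complex values. -/
lemma norm_fderiv_apply_le_gradNorm (f : EuclideanSpace ℝ (Fin n) → 𝕜)
    (x v : EuclideanSpace ℝ (Fin n)) : ‖fderiv ℝ f x v‖ ≤ gradNorm f x * ‖v‖ := by
  have hv : v = ∑ i, v i • EuclideanSpace.single i (1 : ℝ) := by
    ext j
    simp [Finset.sum_apply, Pi.single_apply]
  calc ‖fderiv ℝ f x v‖ = ‖∑ i, v i • fderiv ℝ f x (EuclideanSpace.single i (1 : ℝ))‖ := by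
        conv_lhs => rw [hv]
        rw [map_sum]; simp_rw [map_smul]
    _ ≤ ∑ i, ‖fderiv ℝ f x (EuclideanSpace.single i (1 : ℝ))‖ * |v i| := by
        refine (norm_sum_le _ _).trans (Finset.sum_le_sum fun i _ => ?_)
        rw [norm_smul, mul_comm, Real.norm_eq_abs]
    _ ≤ _ := by
        refine (Real.sum_mul_le_sqrt_mul_sqrt _ _ _).trans (le_of_eq ?_)
        rw [gradNorm, EuclideanSpace.norm_eq]
        simp_rw [Real.norm_eq_abs]

lemma continuous_gradNorm {f : EuclideanSpace ℝ (Fin n) → 𝕜} (hf : ContDiff ℝ ∞ f) :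
    Continuous (gradNorm f) := by
  have := hf.continuous_fderiv (by simp)
  unfold gradNorm
  fun_prop

lemma hasCompactSupport_gradNorm {f : EuclideanSpace ℝ (Fin n) → 𝕜} (hf : HasCompactSupport f) :
    HasCompactSupport (gradNorm f) :=
  (hf.fderiv (𝕜 := ℝ)).comp_left (g := fun L : EuclideanSpace ℝ (Fin n) →L[ℝ] 𝕜 =>
    Real.sqrt (∑ i : Fin n, ‖L (EuclideanSpace.single i (1 : ℝ))‖ ^ 2)) (by simp)

/-- The fundamental theorem of calculus along the segment. -/
lemma isUpperGradient_reflect {f : EuclideanSpace ℝ (Fin n) → 𝕜} (hf : ContDiff ℝ ∞ f)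
    (x : EuclideanSpace ℝ (Fin n)) :
    IsUpperGradient (fun y => ENNReal.ofReal (gradNorm f (x - y))) (fun y => f (x - y)) := by
  intro y θ r hr
  have hθ : ‖(θ : EuclideanSpace ℝ (Fin n))‖ = 1 := by simp
  have hder : ∀ s : ℝ, HasDerivAt (fun s : ℝ => f (x - (y + s • (θ : EuclideanSpace ℝ (Fin n)))))
      (fderiv ℝ f (x - (y + s • (θ : EuclideanSpace ℝ (Fin n)))) (-θ)) s := by
    intro s
    have h1 : HasDerivAt (fun s : ℝ => x - (y + s • (θ : EuclideanSpace ℝ (Fin n)))) (-θ) s := by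
      have := (((hasDerivAt_id s).smul_const (θ : EuclideanSpace ℝ (Fin n))).const_add y).const_sub x
      simpa using this
    exact ((hf.differentiable (by simp)) _).hasFDerivAt.comp_hasDerivAt s h1
  have hcont : Continuous fun s : ℝ =>
      fderiv ℝ f (x - (y + s • (θ : EuclideanSpace ℝ (Fin n)))) (-θ) := by
    have := hf.continuous_fderiv (by simp)
    fun_prop
  have hftc := intervalIntegral.integral_eq_sub_of_hasDerivAt (a := 0) (b := r)
    (fun s _ => hder s) (hcont.intervalIntegrable _ _)
  rw [zero_smul, add_zero] at hftc
  rw [← enorm_neg, neg_sub, ← hftc, intervalIntegral.integral_of_le hr.le]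
  refine (enorm_integral_le_lintegral_enorm _).trans (lintegral_mono fun s => ?_)
  rw [← ofReal_norm]
  apply ENNReal.ofReal_le_ofReal
  refine (norm_fderiv_apply_le_gradNorm _ _ _).trans ?_
  rw [norm_neg, hθ, mul_one]

/-- The ball of radius 4R about any vector of length R contains the given ball, so the cone estimate
with δ = 1 suffices. -/
lemma integrableOn_homogeneousExt_closedBall (hn : 0 < n)
    {Ω : sphere (0 : EuclideanSpace ℝ (Fin n)) 1 → 𝕜}
    (hΩ : MemWeakLp (n : ℝ) (surfaceMeasure n) Ω) {R : ℝ} (hR : 0 < R) :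
    IntegrableOn (homogeneousExt Ω) (closedBall 0 R) := by
  refine ⟨(aestronglyMeasurable_homogeneousExt hn hΩ.1).restrict, ?_⟩
  obtain ⟨C, hC, h⟩ := lintegral_homogeneousExt_closedBall_le (𝕜 := 𝕜) hn
  set z : EuclideanSpace ℝ (Fin n) := EuclideanSpace.single ⟨0, hn⟩ R with hz
  have hzn : ‖z‖ = R := by simp [hz, abs_of_pos hR]
  have h1 := h Ω hΩ z 1 (by rw [← norm_pos_iff, hzn]; exact hR) one_pos le_rfl
  refine lt_of_le_of_lt ((lintegral_mono_set fun y hy => ?_).trans h1) ENNReal.ofReal_lt_top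
  rw [mem_closedBall_zero_iff] at hy
  rw [mem_closedBall, dist_eq_norm, hzn]
  have := norm_sub_le y z
  linarith

lemma aestronglyMeasurable_roughIntegrand (hn : 0 < n) (α : ℝ)
    {Ω : sphere (0 : EuclideanSpace ℝ (Fin n)) 1 → 𝕜}
    (hΩ : AEStronglyMeasurable Ω (surfaceMeasure n)) {f : EuclideanSpace ℝ (Fin n) → 𝕜}
    (hf : Continuous f) (x : EuclideanSpace ℝ (Fin n)) :
    AEStronglyMeasurable (roughIntegrand α Ω f x) volume := by
  unfold roughIntegrand
  exact AEStronglyMeasurable.smul (by fun_prop : Measurable _).aestronglyMeasurable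
    ((aestronglyMeasurable_homogeneousExt hn hΩ).mul (by fun_prop))

lemma integrableOn_roughIntegrand (hn : 0 < n) {α : ℝ} (hαn : α < n)
    {Ω : sphere (0 : EuclideanSpace ℝ (Fin n)) 1 → 𝕜}
    (hΩ : MemWeakLp (n : ℝ) (surfaceMeasure n) Ω) {f : EuclideanSpace ℝ (Fin n) → 𝕜}
    (hf : Continuous f) (hfc : HasCompactSupport f) (x : EuclideanSpace ℝ (Fin n)) {ε : ℝ}
    (hε : 0 < ε) :
    IntegrableOn (roughIntegrand α Ω f x) {y : EuclideanSpace ℝ (Fin n) | ε < ‖y‖} volume := by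
  obtain ⟨M, hM⟩ := hfc.exists_bound_of_continuous hf
  have hM0 : 0 ≤ M := (norm_nonneg _).trans (hM 0)
  obtain ⟨R, hR, hsupp⟩ : ∃ R : ℝ, 0 < R ∧ ∀ y, R < ‖y‖ → f (x - y) = 0 := by
    obtain ⟨R, hR⟩ := hfc.isCompact.isBounded.subset_closedBall x
    refine ⟨max R 1, by positivity, fun y hy => image_eq_zero_of_notMem_tsupport fun h => ?_⟩
    have := hR h
    rw [mem_closedBall, dist_eq_norm, sub_sub_cancel_left, norm_neg] at this
    exact absurd hy (not_lt.2 (this.trans (le_max_left _ _)))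
  have hint : Integrable ((closedBall (0 : EuclideanSpace ℝ (Fin n)) R).indicator
      (homogeneousExt Ω)) :=
    (integrable_indicator_iff measurableSet_closedBall).2
      (integrableOn_homogeneousExt_closedBall hn hΩ hR)
  refine Integrable.mono' ((hint.norm.const_mul ((ε ^ ((n : ℝ) + 1 - α))⁻¹ * M)).integrableOn
    (s := {y : EuclideanSpace ℝ (Fin n) | ε < ‖y‖}))
    (aestronglyMeasurable_roughIntegrand hn α hΩ.1 hf x).restrict ?_
  filter_upwards [ae_restrict_mem (measurableSet_lt measurable_const measurable_norm)] with y hy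
  have hy' : ε < ‖y‖ := hy
  by_cases hyR : R < ‖y‖
  · rw [roughIntegrand, hsupp y hyR, mul_zero, smul_zero, norm_zero]; positivity
  · rw [indicator_of_mem (by simpa using hyR), roughIntegrand, norm_smul, norm_mul,
      Real.norm_of_nonneg (by positivity)]
    have h1 : (‖y‖ ^ ((n : ℝ) + 1 - α))⁻¹ ≤ (ε ^ ((n : ℝ) + 1 - α))⁻¹ := by
      gcongr; linarith
    calc _ ≤ (ε ^ ((n : ℝ) + 1 - α))⁻¹ * (‖homogeneousExt Ω y‖ * M) := by
          gcongr; exact hM _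
      _ = _ := by ring

/-- In polar coordinates the singularity becomes r^(α-1), integrable at 0 because α > 0; the compact
support removes infinity. -/
lemma integrable_div_norm_rpow (hn : 0 < n) {α : ℝ} (hα0 : 0 < α)
    {g : EuclideanSpace ℝ (Fin n) → ℝ} (hg : Continuous g) (hgc : HasCompactSupport g)
    (x : EuclideanSpace ℝ (Fin n)) :
    Integrable (fun y => g y / ‖x - y‖ ^ ((n : ℝ) - α)) volume := by
  have : Nonempty (Fin n) := ⟨⟨0, hn⟩⟩
  obtain ⟨M, hM⟩ := hgc.exists_bound_of_continuous hg
  have hM0 : 0 ≤ M := (norm_nonneg _).trans (hM 0)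
  obtain ⟨R, hR, hsupp⟩ : ∃ R : ℝ, 0 < R ∧ ∀ y, R ≤ ‖y‖ → g (x - y) = 0 := by
    obtain ⟨R, hR⟩ := hgc.isCompact.isBounded.subset_closedBall x
    refine ⟨max R 1 + 1, by positivity, fun y hy => image_eq_zero_of_notMem_tsupport fun h => ?_⟩
    have := hR h
    rw [mem_closedBall, dist_eq_norm, sub_sub_cancel_left, norm_neg] at this
    linarith [le_max_left R 1]
  have h1 : IntegrableOn (fun z : EuclideanSpace ℝ (Fin n) => (‖z‖ ^ ((n : ℝ) - α))⁻¹)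
      (ball 0 R) := by
    rw [integrableOn_fun_norm_addHaar volume (f := fun r : ℝ => (r ^ ((n : ℝ) - α))⁻¹)]
    refine ((intervalIntegral.integrableOn_Ioo_rpow_iff (s := α - 1) hR).2 (by linarith)).congr_fun
      (fun r hr => ?_) measurableSet_Ioo
    have hr0 : 0 < r := hr.1
    simp only [finrank_euclideanSpace_fin, smul_eq_mul]
    rw [← Real.rpow_neg hr0.le, ← Real.rpow_natCast, ← Real.rpow_add hr0, Nat.cast_sub hn]
    congr 1; push_cast; ring
  have h2 : Integrable (fun z : EuclideanSpace ℝ (Fin n) => g (x - z) / ‖z‖ ^ ((n : ℝ) - α)) := by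
    refine Integrable.mono' (((integrable_indicator_iff measurableSet_ball).2 h1).const_mul M)
      (Measurable.aestronglyMeasurable (by fun_prop)) (ae_of_all _ fun z => ?_)
    by_cases hz : R ≤ ‖z‖
    · rw [hsupp z hz, zero_div, norm_zero, indicator_of_notMem (by simpa using hz), mul_zero]
    · rw [indicator_of_mem (by simpa using hz), norm_div, div_eq_mul_inv,
        Real.norm_of_nonneg (r := ‖z‖ ^ ((n : ℝ) - α)) (by positivity)]
      gcongr
      exact hM _
  have h3 := h2.comp_sub_left x
  simpa using h3

/-- Existence of the principal value, and its bound by a Riesz potential of the gradient. -/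
lemma exists_roughOp_bound (hn : 0 < n) {α : ℝ} (hα0 : 0 < α) (hαn : α < n) :
    ∃ C : ℝ, 0 < C ∧ ∀ Ω : sphere (0 : EuclideanSpace ℝ (Fin n)) 1 → 𝕜,
      MemWeakLp (n : ℝ) (surfaceMeasure n) Ω → ∫ θ, Ω θ ∂(surfaceMeasure n) = 0 →
      ∀ f : EuclideanSpace ℝ (Fin n) → 𝕜, ContDiff ℝ ∞ f → HasCompactSupport f →
      ∀ x : EuclideanSpace ℝ (Fin n),
        Tendsto (roughTrunc α Ω f x) (𝓝[>] (0 : ℝ)) (𝓝 (roughOp α Ω f x)) ∧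
        ‖roughOp α Ω f x‖ ≤ C * (weakNorm (n : ℝ) (surfaceMeasure n) Ω).toReal *
          ∫ y, gradNorm f y / ‖x - y‖ ^ ((n : ℝ) - α) := by
  obtain ⟨C, hC, hker⟩ := lintegral_kernel_mul_sub_ballAverage_le (𝕜 := 𝕜) hn hαn
  refine ⟨C, hC, fun Ω hΩ hΩ0 f hf hfc x => ?_⟩
  set a := (weakNorm (n : ℝ) (surfaceMeasure n) Ω).toReal with ha
  have ha0 : 0 ≤ a := ENNReal.toReal_nonneg
  set g : EuclideanSpace ℝ (Fin n) → 𝕜 := fun y => f (x - y) with hg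
  have hgc : Continuous g := by have := hf.continuous; fun_prop
  have hGm : Measurable fun y => ENNReal.ofReal (gradNorm f (x - y)) := by
    have := continuous_gradNorm hf
    fun_prop
  set F : EuclideanSpace ℝ (Fin n) → 𝕜 := fun y => (‖y‖ ^ ((n : ℝ) + 1 - α))⁻¹ •
    (homogeneousExt Ω y * (g y - ballAverage g ‖y‖)) with hF
  have hI := integrable_div_norm_rpow hn hα0 (continuous_gradNorm hf)
    (hasCompactSupport_gradNorm hfc) x
  have hFle : ∫⁻ y, ‖F y‖ₑ ≤
      ENNReal.ofReal (C * a * ∫ y, gradNorm f y / ‖x - y‖ ^ ((n : ℝ) - α)) := by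
    refine (hker Ω hΩ g _ hgc hGm (isUpperGradient_reflect hf x)).trans (le_of_eq ?_)
    rw [ENNReal.ofReal_mul (p := C * a) (by positivity)]
    congr 1
    rw [ofReal_integral_eq_lintegral_ofReal hI
      (ae_of_all _ fun y => div_nonneg (gradNorm_nonneg f y) (by positivity)),
      ← lintegral_sub_left_eq_self (fun y => ENNReal.ofReal
        (gradNorm f y / ‖x - y‖ ^ ((n : ℝ) - α))) x]
    refine lintegral_congr fun z => ?_
    rw [sub_sub_cancel, div_eq_mul_inv, ENNReal.ofReal_mul (gradNorm_nonneg _ _)]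
  have hFm : AEStronglyMeasurable F volume :=
    AEStronglyMeasurable.smul (by fun_prop : Measurable _).aestronglyMeasurable
      ((aestronglyMeasurable_homogeneousExt hn hΩ.1).mul
        (hgc.aestronglyMeasurable.sub (stronglyMeasurable_ballAverage_norm hgc).aestronglyMeasurable))
  have hFint : Integrable F := ⟨hFm, hFle.trans_lt ENNReal.ofReal_lt_top⟩
  have hms : ∀ ε : ℝ, MeasurableSet {y : EuclideanSpace ℝ (Fin n) | ε < ‖y‖} := fun ε =>
    measurableSet_lt measurable_const measurable_norm
  have htrunc : ∀ ε : ℝ, 0 < ε → roughTrunc α Ω f x ε = ∫ y in {y | ε < ‖y‖}, F y := by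
    intro ε hε
    have h1 := integrableOn_roughIntegrand hn hαn hΩ hf.continuous hfc x hε
    -- The difference of the integrands is Ω(y/|y|) times a radial function cut off at ε, so the
    -- mean-zero condition removes it.
    have h2 : ∫ y in {y | ε < ‖y‖}, (roughIntegrand α Ω f x y - F y) = 0 := by
      rw [← integral_indicator (hms ε)]
      rw [← integral_homogeneousExt_mul_radial hn hΩ0
        (fun r => if ε < r then (r ^ ((n : ℝ) + 1 - α))⁻¹ • ballAverage g r else 0)]
      refine integral_congr_ae (ae_of_all _ fun y => ?_)
      simp only
      by_cases hy : ε < ‖y‖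
      · rw [indicator_of_mem (show y ∈ {y | ε < ‖y‖} from hy), if_pos hy, hF, roughIntegrand]
        simp only
        rw [← smul_sub, ← mul_sub, mul_smul_comm, hg]
        simp
      · rw [indicator_of_notMem (show y ∉ {y | ε < ‖y‖} from hy), if_neg hy, mul_zero]
    rw [integral_sub h1 hFint.integrableOn] at h2
    exact sub_eq_zero.1 h2
  have hlim : Tendsto (roughTrunc α Ω f x) (𝓝[>] (0 : ℝ)) (𝓝 (∫ y, F y)) := by
    -- Dominated convergence with majorant |F|; the truncations exhaust everything but the origin, a
    -- null set.
    have h1 : Tendsto (fun ε : ℝ => ∫ y, {y | ε < ‖y‖}.indicator F y) (𝓝[>] (0 : ℝ))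
        (𝓝 (∫ y, ({0}ᶜ : Set (EuclideanSpace ℝ (Fin n))).indicator F y)) := by
      refine tendsto_integral_filter_of_dominated_convergence (fun y => ‖F y‖)
        (Eventually.of_forall fun ε => hFm.indicator (hms ε))
        (Eventually.of_forall fun ε => ae_of_all _ fun y => norm_indicator_le_norm_self _ _)
        hFint.norm (ae_of_all _ fun y => ?_)
      by_cases hy : y = 0
      · refine tendsto_const_nhds.congr' ?_
        filter_upwards [self_mem_nhdsWithin] with ε hε
        have hε' : 0 < ε := hε
        rw [indicator_of_notMem (by simp [hy]), indicator_of_notMem (by simp [hy, hε'.le])]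
      · refine tendsto_const_nhds.congr' ?_
        filter_upwards [nhdsWithin_le_nhds (Iio_mem_nhds (norm_pos_iff.2 hy))] with ε hε
        rw [indicator_of_mem (by simpa using hy), indicator_of_mem (by simpa using hε)]
    rw [integral_indicator (measurableSet_singleton _).compl, restrict_compl_zero hn] at h1
    refine h1.congr' ?_
    filter_upwards [self_mem_nhdsWithin] with ε hε
    rw [htrunc ε hε, integral_indicator (hms ε)]
  have hop : roughOp α Ω f x = ∫ y, F y := hlim.limUnder_eq
  rw [hop]
  refine ⟨hlim, ?_⟩
  have hnn : 0 ≤ C * a * ∫ y, gradNorm f y / ‖x - y‖ ^ ((n : ℝ) - α) :=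
    mul_nonneg (by positivity) (integral_nonneg fun y =>
      div_nonneg (gradNorm_nonneg f y) (by positivity))
  rw [← ENNReal.ofReal_le_ofReal_iff hnn, ofReal_norm]
  exact (enorm_integral_le_lintegral_enorm _).trans hFle

lemma rieszConst_pos {α : ℝ} (hα0 : 0 < α) (hαn : α < n) : 0 < rieszConst n α := by
  have h1 : 0 < Real.Gamma (((n : ℝ) - α) / 2) := Real.Gamma_pos_of_pos (by linarith)
  have h2 : 0 < Real.Gamma (α / 2) := Real.Gamma_pos_of_pos (by linarith)
  unfold rieszConst
  positivity

end PrincipalValue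

/-! ### Shifted dyadic grids and the one-third trick -/

section Grids

variable {n : ℕ}

/-- The relative shift of the cubes of side `2 ^ k` in the `i`-th direction. -/
noncomputable def gridShift (s : Fin n → Bool) (k : ℤ) (i : Fin n) : ℝ :=
  if s i then (-1 : ℝ) ^ k / 3 else 0

/-- The cube of side `2 ^ k` and index `m` in the shifted grid. -/
noncomputable def gridCube (s : Fin n → Bool) (k : ℤ) (m : Fin n → ℤ) : Cube n where
  corner i := 2 ^ k * (m i + gridShift s k i)
  side := 2 ^ k
  side_pos := by positivity

/-- The dyadic grid with one-third shifts in the directions selected by `s`. -/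
noncomputable def dyadicGrid (s : Fin n → Bool) : Set (Cube n) :=
  range fun p : ℤ × (Fin n → ℤ) => gridCube s p.1 p.2

/-- The index of the cube of side `2 ^ k` containing `x`. -/
noncomputable def gridIndex (s : Fin n → Bool) (k : ℤ) (x : EuclideanSpace ℝ (Fin n)) : Fin n → ℤ :=
  fun i => ⌊x i / 2 ^ k - gridShift s k i⌋

/-- The cube of side `2 ^ k` containing `x` in the shifted grid. -/
noncomputable def cubeAt (s : Fin n → Bool) (k : ℤ) (x : EuclideanSpace ℝ (Fin n)) : Cube n :=
  gridCube s k (gridIndex s k x)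

@[simp] lemma side_cubeAt (s : Fin n → Bool) (k : ℤ) (x : EuclideanSpace ℝ (Fin n)) :
    (cubeAt s k x).side = 2 ^ k := rfl

lemma mem_gridCube_iff (s : Fin n → Bool) (k : ℤ) (m : Fin n → ℤ)
    (x : EuclideanSpace ℝ (Fin n)) : x ∈ (gridCube s k m).toSet ↔ gridIndex s k x = m := by
  have h2 : (0 : ℝ) < 2 ^ k := by positivity
  simp only [Cube.toSet, gridCube, mem_ofPred_eq, funext_iff, gridIndex, Int.floor_eq_iff]
  refine forall_congr' fun i => and_congr ?_ ?_
  · rw [le_sub_iff_add_le, le_div_iff₀ h2, mul_comm]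
  · rw [sub_lt_iff_lt_add, div_lt_iff₀ h2]
    constructor <;> intro h <;> linarith

lemma cubeAt_mem_dyadicGrid (s : Fin n → Bool) (k : ℤ) (x : EuclideanSpace ℝ (Fin n)) :
    cubeAt s k x ∈ dyadicGrid s := ⟨(k, gridIndex s k x), rfl⟩

lemma mem_cubeAt_self (s : Fin n → Bool) (k : ℤ) (x : EuclideanSpace ℝ (Fin n)) :
    x ∈ (cubeAt s k x).toSet := (mem_gridCube_iff _ _ _ _).2 rfl

lemma gridIndex_eq_of_mem {s : Fin n → Bool} {k : ℤ} {x y : EuclideanSpace ℝ (Fin n)}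
    (h : y ∈ (cubeAt s k x).toSet) : gridIndex s k y = gridIndex s k x :=
  (mem_gridCube_iff _ _ _ _).1 h

/-- This is where the alternating sign of the shift matters: (-1)^k/3 - 2(-1)^(k+1)/3 = (-1)^k is an
integer. Hence the index at scale k determines the one at scale k + 1 by integer halving, which
makes the cubes nested. -/
lemma gridIndex_succ (s : Fin n → Bool) (k : ℤ) :
    ∃ c : Fin n → ℤ, ∀ x : EuclideanSpace ℝ (Fin n), ∀ i,
      gridIndex s (k + 1) x i = (gridIndex s k x i + c i) / 2 := by
  have hc : ∀ i, ∃ c : ℤ, (c : ℝ) = gridShift s k i - 2 * gridShift s (k + 1) i := by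
    intro i
    unfold gridShift
    by_cases hs : s i
    · refine ⟨if Even k then 1 else -1, ?_⟩
      rw [if_pos hs, if_pos hs, zpow_add_one₀ (by norm_num)]
      split_ifs with hk
      · rw [hk.neg_one_zpow]; norm_num
      · rw [(Int.not_even_iff_odd.1 hk).neg_one_zpow]; norm_num
    · exact ⟨0, by simp [hs]⟩
  choose c hc using hc
  refine ⟨c, fun x i => ?_⟩
  have h2 : (2 : ℝ) ^ k ≠ 0 := by positivity
  have h : x i / 2 ^ (k + 1) - gridShift s (k + 1) i =
      (x i / 2 ^ k - gridShift s k i + c i) / ((2 : ℕ) : ℝ) := by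
    rw [hc, zpow_add_one₀ (by norm_num)]
    push_cast
    field_simp
    ring
  simp only [gridIndex]
  rw [h, Int.floor_div_natCast, Int.floor_add_intCast]
  rfl

lemma gridIndex_eq_of_le {s : Fin n → Bool} {j k : ℤ} (hjk : j ≤ k)
    {x y : EuclideanSpace ℝ (Fin n)} (h : gridIndex s j y = gridIndex s j x) :
    gridIndex s k y = gridIndex s k x := by
  induction k, hjk using Int.leInduction with
  | base => exact h
  | succ k _ ih =>
    obtain ⟨c, hc⟩ := gridIndex_succ s k
    funext i
    rw [hc, hc, ih]

lemma cubeAt_eq_of_mem {s : Fin n → Bool} {j k : ℤ} (hjk : j ≤ k)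
    {x y : EuclideanSpace ℝ (Fin n)} (h : y ∈ (cubeAt s j x).toSet) :
    cubeAt s k y = cubeAt s k x := by
  rw [cubeAt, cubeAt, gridIndex_eq_of_le hjk (gridIndex_eq_of_mem h)]

lemma cubeAt_subset_cubeAt (s : Fin n → Bool) {j k : ℤ} (hjk : j ≤ k)
    (x : EuclideanSpace ℝ (Fin n)) : (cubeAt s j x).toSet ⊆ (cubeAt s k x).toSet := by
  intro y hy
  rw [← cubeAt_eq_of_mem hjk hy]
  exact mem_cubeAt_self _ _ _

lemma eq_cubeAt_of_mem {s : Fin n → Bool} {Q : Cube n} (hQ : Q ∈ dyadicGrid s) {k : ℤ}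
    (hk : Q.side = 2 ^ k) {x : EuclideanSpace ℝ (Fin n)} (hx : x ∈ Q.toSet) : Q = cubeAt s k x := by
  obtain ⟨⟨j, m⟩, rfl⟩ := hQ
  obtain rfl : j = k := zpow_right_injective₀ (by norm_num) (by norm_num) hk
  rw [cubeAt, (mem_gridCube_iff _ _ _ _).1 hx]

lemma isDyadicGrid_dyadicGrid (s : Fin n → Bool) : IsDyadicGrid (dyadicGrid s) where
  side_eq := by
    rintro _ ⟨⟨k, m⟩, rfl⟩
    exact ⟨k, rfl⟩
  partition k x := ⟨cubeAt s k x, ⟨cubeAt_mem_dyadicGrid s k x, rfl, mem_cubeAt_self s k x⟩,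
    fun _ hQ => eq_cubeAt_of_mem hQ.1 hQ.2.1 hQ.2.2⟩
  nested := by
    rintro _ ⟨⟨j, m⟩, rfl⟩ _ ⟨⟨k, l⟩, rfl⟩
    rcases ((gridCube s j m).toSet ∩ (gridCube s k l).toSet).eq_empty_or_nonempty with h | h
    · exact Or.inl h
    · obtain ⟨x, hx1, hx2⟩ := h
      have e1 : gridCube s j m = cubeAt s j x := eq_cubeAt_of_mem ⟨(j, m), rfl⟩ rfl hx1
      have e2 : gridCube s k l = cubeAt s k x := eq_cubeAt_of_mem ⟨(k, l), rfl⟩ rfl hx2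
      simp only [e1, e2, inter_eq_left, inter_eq_right]
      exact Or.inr ((le_total j k).imp (cubeAt_subset_cubeAt s · x) (cubeAt_subset_cubeAt s · x))

lemma Cube.toSet_eq_preimage (Q : Cube n) : Q.toSet = (WithLp.ofLp (p := 2)) ⁻¹'
    (univ.pi fun i => Ico (Q.corner i) (Q.corner i + Q.side)) := by
  ext x
  simp [Cube.toSet]

lemma Cube.measurableSet_toSet (Q : Cube n) : MeasurableSet Q.toSet := by
  rw [Q.toSet_eq_preimage]
  exact (PiLp.volume_preserving_ofLp (Fin n)).measurable
    (MeasurableSet.univ_pi fun _ => measurableSet_Ico)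

lemma Cube.volume_toSet (Q : Cube n) : volume Q.toSet = ENNReal.ofReal Q.side ^ n := by
  rw [Q.toSet_eq_preimage, (PiLp.volume_preserving_ofLp (Fin n)).measure_preimage
    (MeasurableSet.univ_pi fun _ => measurableSet_Ico).nullMeasurableSet, Real.volume_pi_Ico]
  simp

/-- If the interval of radius 1/8 about u avoids crossing an integer, no shift is needed. Otherwise
all its points are within 1/4 of one integer, and a shift by 1/3 in either direction moves them
strictly between two consecutive integers. -/
lemma exists_floor_sub_eq (u : ℝ) (k : ℤ) : ∃ b : Bool, ∀ v : ℝ, |v - u| ≤ 1 / 8 →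
    ⌊v - if b then (-1 : ℝ) ^ k / 3 else 0⌋ = ⌊u - if b then (-1 : ℝ) ^ k / 3 else 0⌋ := by
  by_cases h : ⌊u - 1 / 8⌋ = ⌊u + 1 / 8⌋
  · refine ⟨false, fun v hv => ?_⟩
    have hv' := abs_le.1 hv
    simp only [Bool.false_eq_true, if_false, sub_zero]
    have h1 : ⌊u - 1 / 8⌋ ≤ ⌊v⌋ := Int.floor_mono (by linarith)
    have h2 : ⌊v⌋ ≤ ⌊u + 1 / 8⌋ := Int.floor_mono (by linarith)
    have h3 : ⌊u - 1 / 8⌋ ≤ ⌊u⌋ := Int.floor_mono (by linarith)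
    have h4 : ⌊u⌋ ≤ ⌊u + 1 / 8⌋ := Int.floor_mono (by linarith)
    omega
  · refine ⟨true, fun v hv => ?_⟩
    have hv' := abs_le.1 hv
    set m := ⌊u + 1 / 8⌋ with hm
    have h1 : (m : ℝ) ≤ u + 1 / 8 := Int.floor_le _
    have h2 : u - 1 / 8 < m := by
      rw [← Int.floor_lt]
      exact lt_of_le_of_ne (Int.floor_mono (by linarith)) h
    have key : ∀ w : ℝ, |w - u| ≤ 1 / 8 →
        ⌊w - (-1 : ℝ) ^ k / 3⌋ = if Even k then m - 1 else m := by
      intro w hw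
      have hw' := abs_le.1 hw
      rw [Int.floor_eq_iff]
      split_ifs with hk
      · rw [hk.neg_one_zpow]; push_cast; constructor <;> linarith
      · rw [(Int.not_even_iff_odd.1 hk).neg_one_zpow]; constructor <;> linarith
    simp only [if_true]
    rw [key v hv, key u (by simp)]

/-- The one-third trick: a ball is contained in a cube of comparable size of one of the grids. -/
lemma exists_closedBall_subset_cubeAt (k : ℤ) (x : EuclideanSpace ℝ (Fin n)) :
    ∃ s : Fin n → Bool, closedBall x (2 ^ k) ⊆ (cubeAt s (k + 3) x).toSet := by
  -- The radius is one eighth of the side 2^(k+3). The shift is chosen separately in each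
  -- coordinate, which is why 2^n grids are used.
  choose s hs using fun i => exists_floor_sub_eq (x i / 2 ^ (k + 3)) (k + 3)
  refine ⟨s, fun y hy => (mem_gridCube_iff _ _ _ _).2 (funext fun i => hs i _ ?_)⟩
  have h1 : |y i - x i| ≤ 2 ^ k := by
    have h := PiLp.norm_apply_le (y - x) i
    rw [mem_closedBall, dist_eq_norm] at hy
    exact h.trans hy
  have h2 : (2 : ℝ) ^ (k + 3) = 2 ^ k * 8 := by rw [zpow_add₀ (by norm_num)]; norm_num
  have h3 : (0 : ℝ) < 2 ^ k := by positivity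
  rw [← sub_div, abs_div, abs_of_pos (by positivity : (0 : ℝ) < 2 ^ (k + 3)), h2,
    div_le_div_iff₀ (by positivity) (by norm_num)]
  linarith

end Grids

/-! ### Stopping cubes and sparseness -/

section Stopping

variable {n : ℕ}

/-- The mean density of a measure on a cube. -/
noncomputable def density (ν : Measure (EuclideanSpace ℝ (Fin n))) (Q : Cube n) : ℝ≥0∞ :=
  ν Q.toSet / volume Q.toSet

lemma Cube.volume_toSet_ne_zero (Q : Cube n) : volume Q.toSet ≠ 0 := by
  rw [Q.volume_toSet]
  exact pow_ne_zero _ (ENNReal.ofReal_pos.2 Q.side_pos).ne'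

lemma Cube.volume_toSet_ne_top (Q : Cube n) : volume Q.toSet ≠ ⊤ := by
  rw [Q.volume_toSet]
  exact ENNReal.pow_ne_top ENNReal.ofReal_ne_top

lemma density_mul_volume (ν : Measure (EuclideanSpace ℝ (Fin n))) (Q : Cube n) :
    density ν Q * volume Q.toSet = ν Q.toSet :=
  ENNReal.div_mul_cancel Q.volume_toSet_ne_zero Q.volume_toSet_ne_top

lemma density_ne_top (ν : Measure (EuclideanSpace ℝ (Fin n))) [IsFiniteMeasure ν] (Q : Cube n) :
    density ν Q ≠ ⊤ := ENNReal.div_ne_top (measure_ne_top _ _) Q.volume_toSet_ne_zero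

lemma volume_cubeAt_succ (s : Fin n → Bool) (k : ℤ) (x : EuclideanSpace ℝ (Fin n)) :
    volume (cubeAt s (k + 1) x).toSet = 2 ^ n * volume (cubeAt s k x).toSet := by
  rw [Cube.volume_toSet, Cube.volume_toSet, side_cubeAt, side_cubeAt, zpow_add_one₀ (by norm_num),
    mul_comm, ENNReal.ofReal_mul (by norm_num), mul_pow]
  simp

/-- The measure is finite while volumes grow without bound, so large cubes have small density. This
provides the largest scale at which a level is exceeded. -/
lemma exists_density_le (hn : 0 < n) (s : Fin n → Bool)
    (ν : Measure (EuclideanSpace ℝ (Fin n))) [IsFiniteMeasure ν] {c : ℝ≥0∞} (hc : c ≠ 0)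
    (x : EuclideanSpace ℝ (Fin n)) : ∃ J : ℤ, ∀ i, c < density ν (cubeAt s i x) → i ≤ J := by
  by_cases hctop : c = ⊤
  · exact ⟨0, fun i hi => absurd hi (by simp [hctop])⟩
  obtain ⟨N, hN⟩ := ENNReal.exists_nat_gt (r := ν univ / c)
    (ENNReal.div_ne_top (measure_ne_top _ _) hc)
  refine ⟨N, fun i hi => ?_⟩
  by_contra! hlt
  refine absurd hi (not_lt.2 ?_)
  rw [density]
  refine ENNReal.div_le_of_le_mul ?_
  have h1 : ν univ ≤ N * c := (ENNReal.div_le_iff hc hctop).1 hN.le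
  have h2 : (N : ℝ≥0∞) ≤ volume (cubeAt s i x).toSet := by
    rw [Cube.volume_toSet, side_cubeAt, ← ENNReal.ofReal_pow (by positivity),
      ← ENNReal.ofReal_natCast]
    apply ENNReal.ofReal_le_ofReal
    have h3 : (N : ℝ) ≤ 2 ^ i := by
      have h4 : (N : ℝ) ≤ 2 ^ N := by exact_mod_cast N.lt_two_pow_self.le
      refine h4.trans ?_
      rw [← zpow_natCast]
      exact zpow_le_zpow_right₀ (by norm_num) hlt.le
    rcases Nat.eq_zero_or_pos N with rfl | hN0
    · simp; positivity
    · have h5 : (1 : ℝ) ≤ 2 ^ i := le_trans (by exact_mod_cast hN0) h3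
      exact h3.trans (le_self_pow₀ h5 hn.ne')
  calc ν (cubeAt s i x).toSet ≤ ν univ := measure_mono (subset_univ _)
    _ ≤ N * c := h1
    _ ≤ volume (cubeAt s i x).toSet * c := by gcongr
    _ = _ := mul_comm _ _

lemma exists_greatest_density (hn : 0 < n) (s : Fin n → Bool)
    (ν : Measure (EuclideanSpace ℝ (Fin n))) [IsFiniteMeasure ν] {c : ℝ≥0∞} (hc : c ≠ 0)
    (x : EuclideanSpace ℝ (Fin n)) {j : ℤ} (hj : c < density ν (cubeAt s j x)) :
    ∃ i, j ≤ i ∧ c < density ν (cubeAt s i x) ∧ ∀ i', i < i' → density ν (cubeAt s i' x) ≤ c := by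
  obtain ⟨i, h1, h2⟩ := Int.exists_greatest_of_bdd (P := fun i => c < density ν (cubeAt s i x))
    (exists_density_le hn s ν hc x) ⟨j, hj⟩
  exact ⟨i, h2 j hj, h1, fun i' hi' => not_lt.1 fun h => absurd (h2 i' h) (not_le.2 hi')⟩

/-- The base of the stopping levels. -/
noncomputable def stopBase (n : ℕ) : ℝ≥0∞ := 2 ^ (n + 1)

lemma one_lt_stopBase (n : ℕ) : 1 < stopBase n :=
  one_lt_pow₀ (by norm_num) (by omega)

lemma stopBase_ne_zero (n : ℕ) : stopBase n ≠ 0 := (zero_lt_one.trans (one_lt_stopBase n)).ne'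

lemma stopBase_ne_top (n : ℕ) : stopBase n ≠ ⊤ := ENNReal.pow_ne_top (by norm_num)

/-- The scale `j` is a stopping scale at `x`: the density crosses a level for the first time when
the cubes containing `x` shrink. -/
def IsStopping (s : Fin n → Bool) (ν : Measure (EuclideanSpace ℝ (Fin n))) (j : ℤ)
    (x : EuclideanSpace ℝ (Fin n)) : Prop :=
  ∃ k : ℤ, stopBase n ^ k < density ν (cubeAt s j x) ∧
    ∀ i, j < i → density ν (cubeAt s i x) ≤ stopBase n ^ k

/-- The family of stopping cubes. -/
def stoppingFamily (s : Fin n → Bool) (ν : Measure (EuclideanSpace ℝ (Fin n))) : Set (Cube n) :=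
  {Q | ∃ j x, Q = cubeAt s j x ∧ IsStopping s ν j x}

lemma stoppingFamily_subset (s : Fin n → Bool) (ν : Measure (EuclideanSpace ℝ (Fin n))) :
    stoppingFamily s ν ⊆ dyadicGrid s := by
  rintro _ ⟨j, x, rfl, _⟩
  exact cubeAt_mem_dyadicGrid s j x

lemma countable_dyadicGrid (s : Fin n → Bool) : (dyadicGrid s).Countable := countable_range _

/-- Weak-type bound for the dyadic maximal function, localized to a cube. -/
lemma volume_biUnion_density_le (s : Fin n → Bool)
    (ν : Measure (EuclideanSpace ℝ (Fin n))) {c : ℝ≥0∞}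
    (j : ℤ) (x : EuclideanSpace ℝ (Fin n)) :
    c * volume {y | y ∈ (cubeAt s j x).toSet ∧ ∃ i, i < j ∧ c < density ν (cubeAt s i y)} ≤
      ν (cubeAt s j x).toSet := by
  -- The maximal cubes below scale `j` with density above `c`. Maximality and nestedness make them
  -- disjoint, so their masses add up to at most that of the big cube.
  set M : Set (Cube n) := {P | ∃ y i, y ∈ (cubeAt s j x).toSet ∧ i < j ∧ P = cubeAt s i y ∧
    c < density ν P ∧ ∀ i', i < i' → i' < j → density ν (cubeAt s i' y) ≤ c} with hM
  have hMc : M.Countable := by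
    refine (countable_dyadicGrid s).mono ?_
    rintro _ ⟨y, i, _, _, rfl, _⟩
    exact cubeAt_mem_dyadicGrid s i y
  have hcover : {y | y ∈ (cubeAt s j x).toSet ∧ ∃ i, i < j ∧ c < density ν (cubeAt s i y)} ⊆
      ⋃ P ∈ M, P.toSet := by
    rintro y ⟨hy, i, hij, hi⟩
    obtain ⟨i₁, ⟨h1, h2⟩, h3⟩ := Int.exists_greatest_of_bdd
      (P := fun i => i < j ∧ c < density ν (cubeAt s i y)) ⟨j, fun z hz => hz.1.le⟩ ⟨i, hij, hi⟩
    refine mem_biUnion (x := cubeAt s i₁ y) ⟨y, i₁, hy, h1, rfl, h2, fun i' hi' hi'j => ?_⟩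
      (mem_cubeAt_self s i₁ y)
    exact not_lt.1 fun h => absurd (h3 i' ⟨hi'j, h⟩) (not_le.2 hi')
  have hdisj : M.PairwiseDisjoint Cube.toSet := by
    rintro _ ⟨y, i, hy, hij, rfl, hc, hmax⟩ _ ⟨y', i', hy', hij', rfl, hc', hmax'⟩ hne
    refine Set.disjoint_left.2 fun z hz hz' => hne ?_
    have e1 := cubeAt_eq_of_mem le_rfl hz
    have e2 := cubeAt_eq_of_mem le_rfl hz'
    rcases lt_trichotomy i i' with h | rfl | h
    · have := hmax i' h hij'
      rw [← cubeAt_eq_of_mem h.le hz, e2] at this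
      exact absurd hc' (not_lt.2 this)
    · rw [← e1, ← e2]
    · have := hmax' i h hij
      rw [← cubeAt_eq_of_mem h.le hz', e1] at this
      exact absurd hc (not_lt.2 this)
  have hMs : ∀ P ∈ M, MeasurableSet P.toSet := fun P _ => P.measurableSet_toSet
  calc _ ≤ c * volume (⋃ P ∈ M, P.toSet) := by gcongr
    _ = ∑' P : M, c * volume P.1.toSet := by
        rw [measure_biUnion hMc hdisj hMs, ENNReal.tsum_mul_left]
    _ ≤ ∑' P : M, ν P.1.toSet := by
        refine ENNReal.tsum_le_tsum fun P => ?_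
        obtain ⟨y, i, _, _, _, hc, _⟩ := P.2
        rw [← density_mul_volume ν P.1]
        gcongr
    _ = ν (⋃ P ∈ M, P.toSet) := (measure_biUnion hMc hdisj hMs).symm
    _ ≤ ν (cubeAt s j x).toSet := by
        refine measure_mono (iUnion₂_subset ?_)
        rintro _ ⟨y, i, hy, hij, rfl, _⟩
        rw [← cubeAt_eq_of_mem le_rfl hy]
        exact cubeAt_subset_cubeAt s hij.le y

/-- If Q is a stopping cube for level k, its parent has density at most b^k with b = 2^(n+1), so
ν(Q) ≤ b^k 2^n |Q|. Smaller stopping cubes meeting Q have density above b^(k+1), so by the weak-type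
bound the part of Q they cover has measure at most 2^n |Q| / b = |Q|/2. -/
lemma isSparse_stoppingFamily (s : Fin n → Bool)
    (ν : Measure (EuclideanSpace ℝ (Fin n))) [IsFiniteMeasure ν] :
    IsSparse (stoppingFamily s ν) := by
  set S := stoppingFamily s ν with hS
  have hSD : S ⊆ dyadicGrid s := stoppingFamily_subset s ν
  refine ⟨⟨dyadicGrid s, isDyadicGrid_dyadicGrid s, hSD⟩,
    fun Q => Q.toSet \ ⋃ P ∈ {P ∈ S | P.side < Q.side}, P.toSet, ?_, ?_⟩
  · rintro _ ⟨j, x, rfl, k, hk, hmax⟩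
    set Q := cubeAt s j x with hQ
    have hU : MeasurableSet (⋃ P ∈ {P ∈ S | P.side < Q.side}, P.toSet) :=
      MeasurableSet.biUnion ((countable_dyadicGrid s).mono ((sep_subset _ _).trans hSD))
        fun P _ => P.measurableSet_toSet
    refine ⟨Q.measurableSet_toSet.diff hU, sdiff_subset, ?_⟩
    set U := ⋃ P ∈ {P ∈ S | P.side < Q.side}, P.toSet with hUdef
    -- A smaller stopping cube of level k' meeting Q has Q as an ancestor, so b^k < density(Q) ≤
    -- b^k'. Thus k' ≥ k + 1.
    have hsub : Q.toSet ∩ U ⊆ {y | y ∈ (cubeAt s j x).toSet ∧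
        ∃ i, i < j ∧ stopBase n ^ (k + 1) < density ν (cubeAt s i y)} := by
      rintro y ⟨hyQ, hyU⟩
      obtain ⟨P, ⟨⟨i, x', rfl, k', hk', hmax'⟩, hside⟩, hyP⟩ := mem_iUnion₂.1 hyU
      rw [side_cubeAt, hQ, side_cubeAt, zpow_lt_zpow_iff_right₀ (by norm_num)] at hside
      refine ⟨hyQ, i, hside, ?_⟩
      have h1 := hmax' j hside
      rw [← cubeAt_eq_of_mem hside.le hyP, cubeAt_eq_of_mem le_rfl hyQ] at h1
      have h2 : stopBase n ^ k < stopBase n ^ k' := hk.trans_le h1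
      have h3 : k < k' := by
        by_contra! h
        exact absurd h2 (not_lt.2 (ENNReal.zpow_le_of_le (one_lt_stopBase n).le h))
      rw [cubeAt_eq_of_mem le_rfl hyP]
      exact (ENNReal.zpow_le_of_le (one_lt_stopBase n).le (by omega)).trans_lt hk'
    have hb0 : stopBase n ^ k ≠ 0 := (ENNReal.zpow_pos (stopBase_ne_zero n) (stopBase_ne_top n) k).ne'
    have hbt : stopBase n ^ k ≠ ⊤ :=
      (ENNReal.zpow_lt_top (stopBase_ne_zero n) (stopBase_ne_top n) k).ne
    have hν : ν Q.toSet ≤ stopBase n ^ k * (2 ^ n * volume Q.toSet) := by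
      calc ν Q.toSet ≤ ν (cubeAt s (j + 1) x).toSet :=
            measure_mono (cubeAt_subset_cubeAt s (by omega) x)
        _ = density ν (cubeAt s (j + 1) x) * (2 ^ n * volume Q.toSet) := by
            rw [← density_mul_volume, volume_cubeAt_succ]
        _ ≤ _ := by gcongr; exact hmax _ (by omega)
    have hUle : 2 * volume (Q.toSet ∩ U) ≤ volume Q.toSet := by
      have h1 : stopBase n ^ (k + 1) * volume (Q.toSet ∩ U) ≤
          stopBase n ^ k * (2 ^ n * volume Q.toSet) :=
        ((mul_le_mul' le_rfl (measure_mono hsub)).trans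
          (volume_biUnion_density_le s ν j x)).trans hν
      have h2 : stopBase n ^ (k + 1) = stopBase n ^ k * (2 ^ n * 2) := by
        rw [ENNReal.zpow_add (stopBase_ne_zero n) (stopBase_ne_top n), zpow_one, ← pow_succ]
        rfl
      rw [h2, mul_assoc, ENNReal.mul_le_mul_iff_right hb0 hbt, mul_assoc,
        ENNReal.mul_le_mul_iff_right (by positivity) (ENNReal.pow_ne_top (by norm_num))] at h1
      exact h1
    have hsplit := measure_inter_add_sdiff (μ := volume) Q.toSet hU
    have hfin : volume (Q.toSet ∩ U) ≠ ⊤ :=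
      ((measure_mono inter_subset_left).trans_lt Q.volume_toSet_ne_top.lt_top).ne
    have h3 : volume (Q.toSet ∩ U) ≤ volume (Q.toSet \ U) := by
      rw [← hsplit, two_mul, ENNReal.add_le_add_iff_left hfin] at hUle
      exact hUle
    rw [← hsplit, two_mul]
    gcongr
  · intro P hP Q hQ hne
    refine Set.disjoint_left.2 fun z hzP hzQ => hne ?_
    obtain ⟨i, hi⟩ := (isDyadicGrid_dyadicGrid s).side_eq P (hSD hP)
    obtain ⟨j, hj⟩ := (isDyadicGrid_dyadicGrid s).side_eq Q (hSD hQ)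
    rcases lt_trichotomy P.side Q.side with h | h | h
    · exact absurd (mem_biUnion (show P ∈ {P ∈ S | P.side < Q.side} from ⟨hP, h⟩) hzP.1) hzQ.2
    · rw [eq_cubeAt_of_mem (hSD hP) hi hzP.1, ← eq_cubeAt_of_mem (hSD hQ) (h ▸ hi) hzQ.1]
    · exact absurd (mem_biUnion (show Q ∈ {Q ∈ S | Q.side < P.side} from ⟨hQ, h⟩) hzQ.1) hzP.2

/-- The weight `2 ^ (j α)`. -/
noncomputable def scaleWeight (α : ℝ) (j : ℤ) : ℝ≥0∞ := ENNReal.ofReal (((2 : ℝ) ^ j) ^ α)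

lemma scaleWeight_sub (α : ℝ) (j : ℤ) (l : ℕ) :
    scaleWeight α (j - l) = scaleWeight α j * ENNReal.ofReal (((2 : ℝ) ^ (-α)) ^ l) := by
  rw [scaleWeight, scaleWeight, ← ENNReal.ofReal_mul (by positivity)]
  congr 1
  rw [zpow_sub₀ (by norm_num), Real.div_rpow (by positivity) (by positivity), Real.rpow_neg
    (by norm_num), inv_pow, div_eq_mul_inv, zpow_natCast, ← Real.rpow_natCast, ← Real.rpow_natCast,
    ← Real.rpow_mul (by norm_num), ← Real.rpow_mul (by norm_num), mul_comm α]

open Classical in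
/-- The full dyadic sum is dominated by the sum over the stopping scales. -/
lemma tsum_scaleWeight_mul_density_le (hn : 0 < n) {α : ℝ} (hα : 0 < α) (s : Fin n → Bool)
    (ν : Measure (EuclideanSpace ℝ (Fin n))) [IsFiniteMeasure ν]
    (x : EuclideanSpace ℝ (Fin n)) :
    ∑' j, scaleWeight α j * density ν (cubeAt s j x) ≤
      ENNReal.ofReal ((1 - (2 : ℝ) ^ (-α))⁻¹) * stopBase n *
        ∑' j, if IsStopping s ν j x then scaleWeight α j * density ν (cubeAt s j x) else 0 := by
  set q : ℝ := 2 ^ (-α) with hq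
  have hq0 : 0 ≤ q := by positivity
  have hq1 : q < 1 := Real.rpow_lt_one_of_one_lt_of_neg (by norm_num) (by linarith)
  set t : ℤ → ℝ≥0∞ := fun j => if IsStopping s ν j x then density ν (cubeAt s j x) else 0 with ht
  -- Take k with b^k < density ≤ b^(k+1) at scale j. The largest scale j + l with density above b^k
  -- is a stopping scale, and its density is at least that at j divided by b.
  have hpt : ∀ j, scaleWeight α j * density ν (cubeAt s j x) ≤
      ∑' l : ℕ, scaleWeight α j * (stopBase n * t (j + l)) := by
    intro j
    rcases eq_or_ne (density ν (cubeAt s j x)) 0 with h0 | h0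
    · rw [h0, mul_zero]; exact zero_le
    obtain ⟨k, hk1, hk2⟩ := ENNReal.exists_mem_Ioc_zpow h0 (density_ne_top ν _)
      (one_lt_stopBase n) (stopBase_ne_top n)
    obtain ⟨i, hji, hi, hmax⟩ := exists_greatest_density hn s ν
      (ENNReal.zpow_pos (stopBase_ne_zero n) (stopBase_ne_top n) k).ne' x hk1
    obtain ⟨l, rfl⟩ := Int.le.dest hji
    refine le_trans ?_ (ENNReal.le_tsum l)
    gcongr
    rw [ht]
    simp only
    rw [if_pos ⟨k, hi, hmax⟩]
    refine hk2.trans ?_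
    rw [ENNReal.zpow_add (stopBase_ne_zero n) (stopBase_ne_top n), zpow_one, mul_comm]
    gcongr
  calc _ ≤ ∑' j, ∑' l : ℕ, scaleWeight α j * (stopBase n * t (j + l)) :=
        ENNReal.tsum_le_tsum hpt
    _ = ∑' l : ℕ, ∑' j, scaleWeight α j * (stopBase n * t (j + l)) := ENNReal.tsum_comm
    -- Reindexing by the stopping scale turns the weight of the smaller cube into 2^(-αl) times that
    -- of the stopping cube, leaving a geometric series in l.
    _ = ∑' l : ℕ, ENNReal.ofReal (q ^ l) * (stopBase n * ∑' j, scaleWeight α j * t j) := by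
        congr 1
        funext l
        rw [← (Equiv.subRight (l : ℤ)).tsum_eq, ← ENNReal.tsum_mul_left, ← ENNReal.tsum_mul_left]
        congr 1
        funext j
        rw [Equiv.subRight_apply, sub_add_cancel, scaleWeight_sub]
        ring
    _ = _ := by
        rw [ENNReal.tsum_mul_right, ← ENNReal.ofReal_tsum_of_nonneg (fun l => by positivity)
          (summable_geometric_of_lt_one hq0 hq1), tsum_geometric_of_lt_one hq0 hq1, mul_assoc]
        congr 3
        funext j
        simp only [ht, mul_ite, mul_zero]

end Stopping

/-! ### Sparse domination of the Riesz potential -/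

section SparseDomination

variable {n : ℕ}

/-- The Riesz potential is dominated by the dyadic sums over the shifted grids. -/
lemma lintegral_div_norm_rpow_le {α : ℝ} (hαn : α < n) {g : EuclideanSpace ℝ (Fin n) → ℝ}
    (hg : Continuous g) (hg0 : ∀ y, 0 ≤ g y) (x : EuclideanSpace ℝ (Fin n)) :
    ∫⁻ y, ENNReal.ofReal (g y / ‖x - y‖ ^ ((n : ℝ) - α)) ≤
      ENNReal.ofReal (16 ^ ((n : ℝ) - α)) * ∑ s : Fin n → Bool, ∑' j, scaleWeight α j *
        density (volume.withDensity fun y => ENNReal.ofReal (g y)) (cubeAt s j x) := by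
  have hβ : 0 < (n : ℝ) - α := by linarith
  set ν := (volume : Measure (EuclideanSpace ℝ (Fin n))).withDensity
    fun y => ENNReal.ofReal (g y) with hν
  have hgm : Measurable fun y => ENNReal.ofReal (g y) := by fun_prop
  -- Each y ≠ x lies in one annulus 2^j < |x - y| ≤ 2^(j+1). At y = x the quotient is a division by
  -- zero, hence 0.
  have hpt : ∀ y, ENNReal.ofReal (g y / ‖x - y‖ ^ ((n : ℝ) - α)) ≤
      ∑' j : ℤ, (closedBall x (2 ^ (j + 1))).indicator (fun y => ENNReal.ofReal (g y)) y *
        ENNReal.ofReal ((((2 : ℝ) ^ j) ^ ((n : ℝ) - α))⁻¹) := by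
    intro y
    rcases eq_or_ne x y with rfl | hxy
    · rw [sub_self, norm_zero, Real.zero_rpow hβ.ne', div_zero, ENNReal.ofReal_zero]
      exact zero_le
    · obtain ⟨j, h1, h2⟩ := exists_mem_Ioc_zpow (norm_pos_iff.2 (sub_ne_zero.2 hxy))
        (one_lt_two : (1 : ℝ) < 2)
      refine le_trans ?_ (ENNReal.le_tsum j)
      rw [indicator_of_mem (by rwa [mem_closedBall, dist_eq_norm, norm_sub_rev]),
        ← ENNReal.ofReal_mul (hg0 y), div_eq_mul_inv]
      have := hg0 y
      gcongr
  have hball : ∀ j : ℤ, ν (closedBall x (2 ^ (j + 1))) *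
      ENNReal.ofReal ((((2 : ℝ) ^ j) ^ ((n : ℝ) - α))⁻¹) ≤
      ENNReal.ofReal (16 ^ ((n : ℝ) - α)) * ∑ s : Fin n → Bool,
        scaleWeight α (j + 4) * density ν (cubeAt s (j + 4) x) := by
    intro j
    -- The ball of radius 2^(j+1) sits in a cube of side 2^(j+4) = 16 · 2^j, whence the factor
    -- 16^(n-α). The grid depends on j, so the sum over all grids is taken.
    obtain ⟨s, hs⟩ := exists_closedBall_subset_cubeAt (j + 1) x
    rw [add_assoc, show (1 : ℤ) + 3 = 4 by norm_num] at hs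
    have h1 : ν (closedBall x (2 ^ (j + 1))) ≤
        density ν (cubeAt s (j + 4) x) * ENNReal.ofReal (2 ^ (j + 4)) ^ n := by
      refine (measure_mono hs).trans (le_of_eq ?_)
      rw [← density_mul_volume, Cube.volume_toSet, side_cubeAt]
    have h2 : ENNReal.ofReal (2 ^ (j + 4)) ^ n *
        ENNReal.ofReal ((((2 : ℝ) ^ j) ^ ((n : ℝ) - α))⁻¹) =
        ENNReal.ofReal (16 ^ ((n : ℝ) - α)) * scaleWeight α (j + 4) := by
      rw [scaleWeight, ← ENNReal.ofReal_pow (by positivity), ← ENNReal.ofReal_mul (by positivity),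
        ← ENNReal.ofReal_mul (by positivity)]
      congr 1
      have e1 : (2 : ℝ) ^ (j + 4) = 2 ^ j * 16 := by rw [zpow_add₀ (by norm_num)]; norm_num
      have e2 : ((2 : ℝ) ^ (j + 4)) ^ n =
          ((2 : ℝ) ^ (j + 4)) ^ ((n : ℝ) - α) * ((2 : ℝ) ^ (j + 4)) ^ α := by
        rw [← Real.rpow_add (by positivity), sub_add_cancel, Real.rpow_natCast]
      rw [e2, e1, Real.mul_rpow (z := (n : ℝ) - α) (by positivity) (by norm_num)]
      have : ((2 : ℝ) ^ j) ^ ((n : ℝ) - α) ≠ 0 := by positivity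
      field_simp
    calc _ ≤ density ν (cubeAt s (j + 4) x) * ENNReal.ofReal (2 ^ (j + 4)) ^ n *
          ENNReal.ofReal ((((2 : ℝ) ^ j) ^ ((n : ℝ) - α))⁻¹) := by gcongr
      _ = ENNReal.ofReal (16 ^ ((n : ℝ) - α)) *
          (scaleWeight α (j + 4) * density ν (cubeAt s (j + 4) x)) := by
          rw [mul_assoc, h2]; ring
      _ ≤ _ := by
          gcongr
          exact Finset.single_le_sum (f := fun s : Fin n → Bool =>
            scaleWeight α (j + 4) * density ν (cubeAt s (j + 4) x)) (fun _ _ => zero_le)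
            (Finset.mem_univ s)
  calc _ ≤ ∫⁻ y, ∑' j : ℤ, (closedBall x (2 ^ (j + 1))).indicator
          (fun y => ENNReal.ofReal (g y)) y *
          ENNReal.ofReal ((((2 : ℝ) ^ j) ^ ((n : ℝ) - α))⁻¹) := lintegral_mono hpt
    _ = ∑' j : ℤ, ν (closedBall x (2 ^ (j + 1))) *
          ENNReal.ofReal ((((2 : ℝ) ^ j) ^ ((n : ℝ) - α))⁻¹) := by
        rw [lintegral_tsum fun j =>
          ((hgm.indicator measurableSet_closedBall).mul_const _).aemeasurable]
        congr 1
        funext j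
        rw [lintegral_mul_const' _ _ (by simp), lintegral_indicator measurableSet_closedBall, hν,
          withDensity_apply _ measurableSet_closedBall]
    _ ≤ ∑' j : ℤ, ENNReal.ofReal (16 ^ ((n : ℝ) - α)) * ∑ s : Fin n → Bool,
        scaleWeight α (j + 4) * density ν (cubeAt s (j + 4) x) := ENNReal.tsum_le_tsum hball
    _ = ∑' j : ℤ, ENNReal.ofReal (16 ^ ((n : ℝ) - α)) * ∑ s : Fin n → Bool,
        scaleWeight α j * density ν (cubeAt s j x) :=
        (Equiv.addRight (4 : ℤ)).tsum_eq (fun j => ENNReal.ofReal (16 ^ ((n : ℝ) - α)) *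
          ∑ s : Fin n → Bool, scaleWeight α j * density ν (cubeAt s j x))
    _ = _ := by
        rw [ENNReal.tsum_mul_left, Summable.tsum_finsetSum fun _ _ => ENNReal.summable]

/-- The dyadic sums of a bounded finite density are finite. -/
lemma tsum_scaleWeight_mul_density_lt_top {α : ℝ} (hα0 : 0 < α) (hαn : α < n) (s : Fin n → Bool)
    (ν : Measure (EuclideanSpace ℝ (Fin n))) [IsFiniteMeasure ν] {M : ℝ} (hM : 0 ≤ M)
    (hν : ν ≤ ENNReal.ofReal M • volume) (x : EuclideanSpace ℝ (Fin n)) :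
    ∑' j, scaleWeight α j * density ν (cubeAt s j x) < ⊤ := by
  set V := ν.real univ with hV
  have hV0 : 0 ≤ V := measureReal_nonneg
  -- The density is at most M, which gives convergence at small scales since α > 0, and at most the
  -- total mass over the volume, which gives it at large scales since α < n.
  set h : ℤ → ℝ := fun j => ((2 : ℝ) ^ j) ^ α * min M (V / ((2 : ℝ) ^ j) ^ n) with hh
  have h0 : ∀ j, 0 ≤ h j := fun j => by positivity
  have hsum : Summable h := by
    refine Summable.of_nat_of_neg ?_ ?_
    · have hr1 : (2 : ℝ) ^ (-((n : ℝ) - α)) < 1 :=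
        Real.rpow_lt_one_of_one_lt_of_neg (by norm_num) (by linarith)
      refine Summable.of_nonneg_of_le (fun j => h0 j) (fun j => ?_)
        ((summable_geometric_of_lt_one (by positivity) hr1).mul_left V)
      calc h j ≤ ((2 : ℝ) ^ (j : ℤ)) ^ α * (V / ((2 : ℝ) ^ (j : ℤ)) ^ n) := by
            simp only [hh]; gcongr; exact min_le_right _ _
        _ = _ := by
          rw [zpow_natCast, ← Real.rpow_natCast _ j, ← Real.rpow_natCast _ n,
            ← Real.rpow_natCast _ j, mul_div_assoc', mul_comm _ V, mul_div_assoc,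
            ← Real.rpow_mul (by norm_num), ← Real.rpow_mul (by norm_num),
            ← Real.rpow_mul (by norm_num), ← Real.rpow_sub (by norm_num)]
          congr 2; ring
    · have hr1 : (2 : ℝ) ^ (-α) < 1 :=
        Real.rpow_lt_one_of_one_lt_of_neg (by norm_num) (by linarith)
      refine Summable.of_nonneg_of_le (fun j => h0 _) (fun j => ?_)
        ((summable_geometric_of_lt_one (by positivity) hr1).mul_left M)
      calc h (-j) ≤ ((2 : ℝ) ^ (-j : ℤ)) ^ α * M := by
            simp only [hh]; gcongr; exact min_le_left _ _
        _ = _ := by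
          rw [mul_comm, zpow_neg, zpow_natCast, ← Real.rpow_natCast _ j, ← Real.rpow_natCast _ j,
            ← Real.rpow_neg (by norm_num), ← Real.rpow_mul (by norm_num),
            ← Real.rpow_mul (by norm_num)]
          congr 2; ring
  refine lt_of_le_of_lt (ENNReal.tsum_le_tsum fun j => ?_) hsum.tsum_ofReal_lt_top
  rw [hh, scaleWeight]
  simp only
  rw [ENNReal.ofReal_mul (by positivity)]
  gcongr
  rw [ENNReal.ofReal_min]
  refine le_min ?_ ?_
  · exact ENNReal.div_le_of_le_mul (hν _)
  · rw [density, Cube.volume_toSet, side_cubeAt, ENNReal.ofReal_div_of_pos (by positivity),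
      ENNReal.ofReal_pow (by positivity), hV, ofReal_measureReal]
    gcongr
    exact subset_univ _

lemma sparseTerm_nonneg (α : ℝ) {g : EuclideanSpace ℝ (Fin n) → ℝ} (hg0 : ∀ y, 0 ≤ g y)
    (x : EuclideanSpace ℝ (Fin n)) (Q : Cube n) : 0 ≤ sparseTerm α g x Q := by
  refine indicator_nonneg (fun _ _ => mul_nonneg (by have := Q.side_pos; positivity) ?_) x
  rw [setAverage_eq]
  exact smul_nonneg (by positivity) (integral_nonneg hg0)

lemma ofReal_sparseTerm_cubeAt (α : ℝ) {g : EuclideanSpace ℝ (Fin n) → ℝ} (hg : Integrable g)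
    (hg0 : ∀ y, 0 ≤ g y) (s : Fin n → Bool) (j : ℤ) (x : EuclideanSpace ℝ (Fin n)) :
    ENNReal.ofReal (sparseTerm α g x (cubeAt s j x)) = scaleWeight α j *
      density (volume.withDensity fun y => ENNReal.ofReal (g y)) (cubeAt s j x) := by
  set Q := cubeAt s j x with hQ
  have hv : 0 < (volume : Measure (EuclideanSpace ℝ (Fin n))).real Q.toSet :=
    ENNReal.toReal_pos Q.volume_toSet_ne_zero Q.volume_toSet_ne_top
  rw [sparseTerm, indicator_of_mem (mem_cubeAt_self s j x), hQ, side_cubeAt, ← hQ,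
    ENNReal.ofReal_mul (by positivity), scaleWeight, setAverage_eq, smul_eq_mul,
    inv_mul_eq_div, ENNReal.ofReal_div_of_pos hv, density,
    withDensity_apply _ Q.measurableSet_toSet,
    ofReal_measureReal Q.volume_toSet_ne_top, ofReal_integral_eq_lintegral_ofReal hg.integrableOn
      (ae_of_all _ hg0)]

/-- Only cubes containing x contribute, at most one per scale. This serves to show that the sparse
sums converge. -/
lemma tsum_sparseTerm_le (α : ℝ) {g : EuclideanSpace ℝ (Fin n) → ℝ} (hg : Integrable g)
    (hg0 : ∀ y, 0 ≤ g y) (s : Fin n → Bool) {S : Set (Cube n)} (hS : S ⊆ dyadicGrid s)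
    (x : EuclideanSpace ℝ (Fin n)) :
    ∑' Q : S, ENNReal.ofReal (sparseTerm α g x Q) ≤ ∑' j, scaleWeight α j *
      density (volume.withDensity fun y => ENNReal.ofReal (g y)) (cubeAt s j x) := by
  classical
  have hpt : ∀ Q : S, ENNReal.ofReal (sparseTerm α g x Q) ≤
      ∑' j, if Q.1 = cubeAt s j x then ENNReal.ofReal (sparseTerm α g x (cubeAt s j x)) else 0 := by
    intro Q
    by_cases hx : x ∈ Q.1.toSet
    · obtain ⟨j, hj⟩ := (isDyadicGrid_dyadicGrid s).side_eq Q (hS Q.2)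
      have hQ := eq_cubeAt_of_mem (hS Q.2) hj hx
      refine le_trans (le_of_eq ?_) (ENNReal.le_tsum j)
      rw [if_pos hQ, ← hQ]
    · rw [sparseTerm, indicator_of_notMem hx, ENNReal.ofReal_zero]; exact zero_le
  refine (ENNReal.tsum_le_tsum hpt).trans ?_
  rw [ENNReal.tsum_comm]
  refine ENNReal.tsum_le_tsum fun j => ?_
  rw [← ofReal_sparseTerm_cubeAt α hg hg0]
  refine (ENNReal.tsum_comp_le_tsum_of_injective (f := ((↑) : S → Cube n)) Subtype.val_injective
    (fun Q => if Q = cubeAt s j x then ENNReal.ofReal (sparseTerm α g x (cubeAt s j x))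
      else 0)).trans ?_
  rw [tsum_ite_eq]

-- Distinct stopping scales at x give stopping cubes of distinct sides, so the sum over scales
-- embeds into the sum over the family, which itself does not depend on x.
open Classical in
lemma tsum_stopping_le (α : ℝ) {g : EuclideanSpace ℝ (Fin n) → ℝ} (hg : Integrable g)
    (hg0 : ∀ y, 0 ≤ g y) (s : Fin n → Bool) (ν : Measure (EuclideanSpace ℝ (Fin n)))
    (hν : ν = volume.withDensity fun y => ENNReal.ofReal (g y)) (x : EuclideanSpace ℝ (Fin n)) :
    (∑' j, if IsStopping s ν j x then scaleWeight α j * density ν (cubeAt s j x) else 0) ≤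
      ∑' Q : stoppingFamily s ν, ENNReal.ofReal (sparseTerm α g x Q) := by
  have h1 : (∑' j, if IsStopping s ν j x then scaleWeight α j * density ν (cubeAt s j x) else 0) =
      ∑' j : {j | IsStopping s ν j x}, scaleWeight α j * density ν (cubeAt s j x) := by
    rw [tsum_subtype {j | IsStopping s ν j x}
      (fun j => scaleWeight α j * density ν (cubeAt s j x))]
    rfl
  rw [h1]
  set e : {j | IsStopping s ν j x} → stoppingFamily s ν :=
    fun j => ⟨cubeAt s j x, j, x, rfl, j.2⟩ with he
  have hinj : Function.Injective e := by
    intro i j hij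
    have h2 : (cubeAt s i x).side = (cubeAt s j x).side := congrArg (fun Q => Q.1.side) hij
    exact Subtype.ext (zpow_right_injective₀ (by norm_num) (by norm_num) h2)
  refine le_trans (le_of_eq ?_) (ENNReal.tsum_comp_le_tsum_of_injective hinj
    fun Q => ENNReal.ofReal (sparseTerm α g x Q))
  congr 1
  funext j
  rw [he, ofReal_sparseTerm_cubeAt α hg hg0, ← hν]

/-- Sparse domination of the Riesz potential of a nonnegative continuous function with compact
support. -/
lemma exists_sparse_domination (hn : 0 < n) {α : ℝ} (hα0 : 0 < α) (hαn : α < n) :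
    ∃ C : ℝ, 0 < C ∧ ∀ g : EuclideanSpace ℝ (Fin n) → ℝ, Continuous g → HasCompactSupport g →
      (∀ y, 0 ≤ g y) → ∃ S : (Fin n → Bool) → Set (Cube n), (∀ s, IsSparse (S s)) ∧
        ∀ x, (∀ s, Summable fun Q : S s => sparseTerm α g x Q) ∧
          ∫ y, g y / ‖x - y‖ ^ ((n : ℝ) - α) ≤ C * ∑ s, sparseOp (S s) α g x := by
  classical
  have hq1 : (2 : ℝ) ^ (-α) < 1 := Real.rpow_lt_one_of_one_lt_of_neg (by norm_num) (by linarith)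
  have hq : 0 < (1 - (2 : ℝ) ^ (-α))⁻¹ := inv_pos.2 (sub_pos.2 hq1)
  refine ⟨16 ^ ((n : ℝ) - α) * ((1 - (2 : ℝ) ^ (-α))⁻¹ * 2 ^ (n + 1)), by positivity,
    fun g hg hgc hg0 => ?_⟩
  have hgi : Integrable g := hg.integrable_of_hasCompactSupport hgc
  obtain ⟨M, hM⟩ := hgc.exists_bound_of_continuous hg
  have hM0 : 0 ≤ M := (norm_nonneg _).trans (hM 0)
  set ν := (volume : Measure (EuclideanSpace ℝ (Fin n))).withDensity
    fun y => ENNReal.ofReal (g y) with hν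
  have hfin : IsFiniteMeasure ν := isFiniteMeasure_withDensity_ofReal hgi.2
  have hνle : ν ≤ ENNReal.ofReal M • volume := by
    rw [← withDensity_const]
    refine withDensity_mono (ae_of_all _ fun y => ENNReal.ofReal_le_ofReal ?_)
    exact (le_abs_self _).trans (hM y)
  -- Finiteness is needed before passing to real sums, since a divergent real `tsum` is 0.
  have hlt : ∀ s x, ∑' Q : stoppingFamily s ν, ENNReal.ofReal (sparseTerm α g x Q) < ⊤ :=
    fun s x => (tsum_sparseTerm_le α hgi hg0 s (stoppingFamily_subset s ν) x).trans_lt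
      (tsum_scaleWeight_mul_density_lt_top hα0 hαn s ν hM0 hνle x)
  have hsummable : ∀ s x, Summable fun Q : stoppingFamily s ν => sparseTerm α g x Q := by
    intro s x
    have h1 := ENNReal.summable_toReal (hlt s x).ne
    refine h1.congr fun Q => ?_
    rw [ENNReal.toReal_ofReal (sparseTerm_nonneg α hg0 x Q)]
  refine ⟨fun s => stoppingFamily s ν, fun s => isSparse_stoppingFamily s ν, fun x =>
    ⟨fun s => hsummable s x, ?_⟩⟩
  have hop0 : ∀ s, 0 ≤ sparseOp (stoppingFamily s ν) α g x := fun s =>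
    tsum_nonneg fun Q => sparseTerm_nonneg α hg0 x Q
  have hop : ∀ s, ENNReal.ofReal (sparseOp (stoppingFamily s ν) α g x) =
      ∑' Q : stoppingFamily s ν, ENNReal.ofReal (sparseTerm α g x Q) := fun s =>
    ENNReal.ofReal_tsum_of_nonneg (fun Q => sparseTerm_nonneg α hg0 x Q) (hsummable s x)
  rw [← ENNReal.ofReal_le_ofReal_iff (mul_nonneg (by positivity)
      (Finset.sum_nonneg fun s _ => hop0 s)),
    ofReal_integral_eq_lintegral_ofReal (integrable_div_norm_rpow hn hα0 hg hgc x)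
      (ae_of_all _ fun y => div_nonneg (hg0 y) (by positivity))]
  refine (lintegral_div_norm_rpow_le hαn hg hg0 x).trans ?_
  rw [ENNReal.ofReal_mul (by positivity), ENNReal.ofReal_mul (by positivity), mul_assoc,
    ENNReal.ofReal_sum_of_nonneg fun s _ => hop0 s]
  refine mul_le_mul' le_rfl ?_
  rw [Finset.mul_sum]
  refine Finset.sum_le_sum fun s _ => ?_
  refine (tsum_scaleWeight_mul_density_le hn hα0 s ν x).trans ?_
  rw [hop, ENNReal.ofReal_mul (by positivity)]
  gcongr
  · rw [stopBase, ENNReal.ofReal_pow (by norm_num)]; simp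
  · exact tsum_stopping_le α hgi hg0 s ν hν x

end SparseDomination

end RoughOperator

theorem theorem1p1 {𝕜 : Type*} [RCLike 𝕜] (n : ℕ) (α : ℝ) (hα0 : 0 < α) (hαn : α < n) :
    ∃ c : ℝ, 0 < c ∧ ∃ N : ℕ,
      ∀ Ω : Metric.sphere (0 : EuclideanSpace ℝ (Fin n)) 1 → 𝕜,
        RoughOperator.MemWeakLp (n : ℝ) (RoughOperator.surfaceMeasure n) Ω →
        ∫ θ, Ω θ ∂(RoughOperator.surfaceMeasure n) = 0 →
      ∀ f : EuclideanSpace ℝ (Fin n) → 𝕜, ContDiff ℝ ∞ f → HasCompactSupport f →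
        -- the principal value, the Riesz potential exist at every point, and the bound holds
        (∀ x : EuclideanSpace ℝ (Fin n),
          (∀ ε : ℝ, 0 < ε →
            IntegrableOn (RoughOperator.roughIntegrand α Ω f x)
              {y : EuclideanSpace ℝ (Fin n) | ε < ‖y‖} volume) ∧
          Tendsto (RoughOperator.roughTrunc α Ω f x) (𝓝[>] (0 : ℝ))
            (𝓝 (RoughOperator.roughOp α Ω f x)) ∧
          Integrable (fun y => RoughOperator.gradNorm f y / ‖x - y‖ ^ ((n : ℝ) - α)) volume ∧
          ‖RoughOperator.roughOp α Ω f x‖ ≤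
            c * (RoughOperator.weakNorm (n : ℝ) (RoughOperator.surfaceMeasure n) Ω).toReal *
              RoughOperator.rieszPotential α (RoughOperator.gradNorm f) x) ∧
        -- the bound by finitely many sparse operators
        ∃ S : Fin N → Set (RoughOperator.Cube n),
          (∀ k, RoughOperator.IsSparse (S k)) ∧
          ∀ x : EuclideanSpace ℝ (Fin n),
            (∀ k, Summable fun Q : S k =>
              RoughOperator.sparseTerm α (RoughOperator.gradNorm f) x Q) ∧
            ‖RoughOperator.roughOp α Ω f x‖ ≤
              c * (RoughOperator.weakNorm (n : ℝ) (RoughOperator.surfaceMeasure n) Ω).toReal *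
                ∑ k, RoughOperator.sparseOp (S k) α (RoughOperator.gradNorm f) x := by
  have hn : 0 < n := by exact_mod_cast hα0.trans hαn
  obtain ⟨C₁, hC₁, h₁⟩ := RoughOperator.exists_roughOp_bound (𝕜 := 𝕜) hn hα0 hαn
  obtain ⟨C₂, hC₂, h₂⟩ := RoughOperator.exists_sparse_domination hn hα0 hαn
  have hr := RoughOperator.rieszConst_pos (n := n) hα0 hαn
  -- One constant for both bounds: the first summand undoes the normalisation of the Riesz
  -- potential, the second combines the principal value bound with sparse domination. There is one
  -- sparse family per shifted grid, so N = 2^n.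
  refine ⟨C₁ / RoughOperator.rieszConst n α + C₁ * C₂, by positivity,
    Fintype.card (Fin n → Bool), fun Ω hΩ hΩ0 f hf hfc => ?_⟩
  have hG := RoughOperator.continuous_gradNorm hf
  have hGc := RoughOperator.hasCompactSupport_gradNorm hfc
  have hG0 := RoughOperator.gradNorm_nonneg f
  set a := (RoughOperator.weakNorm (n : ℝ) (RoughOperator.surfaceMeasure n) Ω).toReal with ha
  have ha0 : 0 ≤ a := ENNReal.toReal_nonneg
  refine ⟨fun x => ⟨fun ε hε => RoughOperator.integrableOn_roughIntegrand hn hαn hΩ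
    hf.continuous hfc x hε, (h₁ Ω hΩ hΩ0 f hf hfc x).1,
    RoughOperator.integrable_div_norm_rpow hn hα0 hG hGc x, ?_⟩, ?_⟩
  · refine (h₁ Ω hΩ hΩ0 f hf hfc x).2.trans ?_
    have hI : 0 ≤ ∫ y, RoughOperator.gradNorm f y / ‖x - y‖ ^ ((n : ℝ) - α) :=
      integral_nonneg fun y => div_nonneg (hG0 y) (by positivity)
    rw [RoughOperator.rieszPotential]
    set I := ∫ y, RoughOperator.gradNorm f y / ‖x - y‖ ^ ((n : ℝ) - α)
    calc C₁ * a * I = C₁ / RoughOperator.rieszConst n α * a *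
          (RoughOperator.rieszConst n α * I) := by field_simp
      _ ≤ _ := by gcongr; exact le_add_of_nonneg_right (by positivity)
  · obtain ⟨S, hS, hdom⟩ := h₂ _ hG hGc hG0
    set e := (Fintype.equivFin (Fin n → Bool)).symm
    refine ⟨fun k => S (e k), fun k => hS _, fun x => ⟨fun k => (hdom x).1 _, ?_⟩⟩
    refine (h₁ Ω hΩ hΩ0 f hf hfc x).2.trans ?_
    rw [e.sum_comp fun s => RoughOperator.sparseOp (S s) α (RoughOperator.gradNorm f) x]
    have hsum : 0 ≤ ∑ s, RoughOperator.sparseOp (S s) α (RoughOperator.gradNorm f) x :=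
      Finset.sum_nonneg fun s _ => tsum_nonneg fun Q => RoughOperator.sparseTerm_nonneg α hG0 x Q
    calc _ ≤ C₁ * a * (C₂ * ∑ s, RoughOperator.sparseOp (S s) α (RoughOperator.gradNorm f) x) := by
          gcongr; exact (hdom x).2
      _ = C₁ * C₂ * a * ∑ s, RoughOperator.sparseOp (S s) α (RoughOperator.gradNorm f) x := by ring
      _ ≤ _ := by gcongr; exact le_add_of_nonneg_left (by positivity)
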